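/- Let $\mathbb F$ be an algebraically closed field of characteristic zero and let $n\ge 1$. Let $\mathfrak h_n$ be the Heisenberg Lie superalgebra with $1$-dimensional odd center $\mathbb Fz$: it has the even basis elements $x_1,\dots,x_n$, the odd basis elements $y_1,\dots,y_n,z$, and the only nonzero brackets of basis elements are $[x_i,y_i]=z=-[y_i,x_i]$ for $1\le i\le n$. For $q\ge 0$ let $H^q(\mathfrak h_n)=Z^q/B^q$ be its cohomology with trivial coefficients, that is, the cohomology of the complex whose $q$-cochains are the $q$-linear forms $\omega$ on $\mathfrak h_n$ with $\omega(\dots,u,v,\dots)=-(-1)^{|u||v|}\omega(\dots,v,u,\dots)$ for homogeneous $u,v$, with coboundary operator, for homogeneous $a_0,\dots,a_q$, $$\mathrm d\omega(a_0,\dots,a_q)=\sum_{r<s}(-1)^{s+|a_s|(|a_{r+1}|+\cdots+|a_{s-1}|)}\,\omega(a_0,\dots,a_{r-1},[a_r,a_s],a_{r+1},\dots,\widehat{a_s},\dots,a_q).$$ For integers $m\ge 0$ and $p$ let $s_m(p)$ be the dimension of the $p$-th symmetric power of an $m$-dimensional vector space if $p\ge 0$, and $s_m(p)=0$ if $p<0$.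 Write $\delta_{a,b}$ for the Kronecker delta, and let $\varepsilon_q=1$ if $q\equiv 2$ or $3 \pmod 4$ and $\varepsilon_q=0$ otherwise. Then, for every integer $q\ge 0$, $H^q(\mathfrak h_n)$ is finite-dimensional and $$\begin{aligned}\dim H^q(\mathfrak h_n)={}&\sum_{p=0}^{q-1}\left[\binom{n+1}{q-p}s_n(p)-\binom{n}{q-1-p}s_{n+1}(p)\right]+s_n(q)\\&+\sum_{i=1}^{\lfloor q/4\rfloor+\varepsilon_q}\Bigg[\sum_{p=0}^{q-4i-1}\binom{n+2}{q-4i+1-p}s_n(p)+(n+2)\,s_n(q-4i)+s_n(q-4i+1)\\&\qquad\qquad\qquad+\delta_{q-4i+1,n}+2\delta_{q-4i+2,n}+\delta_{q-4i+3,n}\Bigg],\end{aligned}$$ where sums with an upper limit smaller than the lower one are empty. -/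

import Mathlib

noncomputable section

/-- A Lie superalgebra structure on the vector space `L`: a `ZMod 2`-grading
`L = grade 0 ⊕ grade 1` (even and odd part) and an even bilinear bracket which is
super-antisymmetric and satisfies the super Jacobi identity. -/
structure LieSuperalgebra (F L : Type*) [Field F] [AddCommGroup L] [Module F L] where
  grade : ZMod 2 → Submodule F L
  isCompl_grade : IsCompl (grade 0) (grade 1)
  bracket : L →ₗ[F] L →ₗ[F] L
  bracket_mem : ∀ {i j : ZMod 2} {a b : L}, a ∈ grade i → b ∈ grade j →
    bracket a b ∈ grade (i + j)
  bracket_skew : ∀ {i j : ZMod 2} {a b : L}, a ∈ grade i → b ∈ grade j →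
    bracket a b = -((-1 : F) ^ (i * j).val • bracket b a)
  jacobi : ∀ {i j k : ZMod 2} {a b c : L}, a ∈ grade i → b ∈ grade j → c ∈ grade k →
    bracket a (bracket b c) =
      bracket (bracket a b) c + (-1 : F) ^ (i * j).val • bracket b (bracket a c)

/-- The quotient `Z / B` of subspaces of `M`, for `B ⊆ Z`. -/
abbrev Subquotient {F M : Type*} [Field F] [AddCommGroup M] [Module F M]
    (Z B : Submodule F M) : Type _ :=
  Z ⧸ B.submoduleOf Z

namespace LieSuperalgebra

variable {F L : Type*} [Field F] [AddCommGroup L] [Module F L] (g : LieSuperalgebra F L)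

theorem isCompl_grade_add_one (i : ZMod 2) : IsCompl (g.grade i) (g.grade (i + 1)) := by
  fin_cases i
  · exact g.isCompl_grade
  · exact g.isCompl_grade.symm

/-- The projection of `L` onto its homogeneous component of parity `i`. -/
def proj (i : ZMod 2) : L →ₗ[F] L := Submodule.projection _ _ (g.isCompl_grade_add_one i)

theorem proj_same {i : ZMod 2} {a : L} (ha : a ∈ g.grade i) : g.proj i a = a :=
  Submodule.projection_apply_of_mem_left _ ha

theorem proj_other {i j : ZMod 2} (hij : i ≠ j) {a : L} (ha : a ∈ g.grade j) :
    g.proj i a = 0 := by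
  have h : j = i + 1 := by
    clear ha
    revert i j
    decide
  subst h
  exact (Submodule.projection_apply_eq_zero_iff _).2 ha

/-- The space of `q`-cochains with trivial coefficients: the `q`-linear forms `ω` on `L` with
`ω(…, u, v, …) = -(-1)^(|u||v|) ω(…, v, u, …)` for homogeneous arguments, that is, the linear
forms on the `q`-th super-exterior power of `L`. -/
def cochains (q : ℕ) : Submodule F (MultilinearMap F (fun _ : Fin q => L) F) where
  carrier := {ω | ∀ (p : Fin q → ZMod 2) (a : Fin q → L), (∀ i, a i ∈ g.grade (p i)) →
    ∀ i j : Fin q, (i : ℕ) + 1 = j →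
      ω (a ∘ Equiv.swap i j) = -((-1 : F) ^ (p i * p j).val * ω a)}
  add_mem' := by
    intro ω η hω hη p a ha i j hij
    simp only [add_apply, hω p a ha i j hij, hη p a ha i j hij]
    ring
  zero_mem' := by
    intro p a ha i j hij
    simp
  smul_mem' := by
    intro c ω hω p a ha i j hij
    simp only [smul_apply, hω p a ha i j hij, smul_eq_mul]
    ring

/-- For `r < s` (`r` being a position in the shortened list),
`(a_0, …, a_q) ↦ ω(a_0, …, a_{r-1}, [a_r, a_s], a_{r+1}, …, â_s, …, a_q)`. -/
def insertBracket {q : ℕ} (s : Fin (q + 1)) (r : Fin q)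
    (ω : MultilinearMap F (fun _ : Fin q => L) F) :
    MultilinearMap F (fun _ : Fin (q + 1) => L) F where
  toFun a := ω (Function.update (s.removeNth a) r (g.bracket (s.removeNth a r) (a s)))
  map_update_add' := by
    intro inst a i x y
    obtain rfl := Subsingleton.elim inst (instDecidableEqFin _)
    obtain rfl | ⟨m, rfl⟩ := Fin.eq_self_or_eq_succAbove s i
    · simp [Fin.removeNth_update]
    · rcases eq_or_ne m r with rfl | hm
      · simp [Fin.removeNth_update_succAbove]
      · simp [Fin.removeNth_update_succAbove, hm.symm, Function.update_comm hm]
  map_update_smul' := by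
    intro inst a i c x
    obtain rfl := Subsingleton.elim inst (instDecidableEqFin _)
    obtain rfl | ⟨m, rfl⟩ := Fin.eq_self_or_eq_succAbove s i
    · simp [Fin.removeNth_update]
    · rcases eq_or_ne m r with rfl | hm
      · simp [Fin.removeNth_update_succAbove]
      · simp [Fin.removeNth_update_succAbove, hm.symm, Function.update_comm hm]

/-- The coboundary formula for arguments `a_0, …, a_q` of parities `p 0, …, p q`:
`∑_{r < s} (-1)^(s + |a_s|(|a_{r+1}| + ⋯ + |a_{s-1}|))
  ω(a_0, …, a_{r-1}, [a_r, a_s], a_{r+1}, …, â_s, …, a_q)`. -/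
def coboundaryFormula {q : ℕ} (p : Fin (q + 1) → ZMod 2)
    (ω : MultilinearMap F (fun _ : Fin q => L) F) :
    MultilinearMap F (fun _ : Fin (q + 1) => L) F :=
  ∑ s : Fin (q + 1), ∑ r : Fin q with r.castSucc < s,
    ((-1 : F) ^ ((s : ℕ) + (p s * ∑ t ∈ Finset.Ioo r.castSucc s, p t).val)) •
      g.insertBracket s r ω

/-- The coboundary operator: the multilinear extension of `coboundaryFormula` from homogeneous
to arbitrary arguments. -/
def d (q : ℕ) : MultilinearMap F (fun _ : Fin q => L) F →ₗ[F]
    MultilinearMap F (fun _ : Fin (q + 1) => L) F where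
  toFun ω := ∑ p : Fin (q + 1) → ZMod 2,
    (g.coboundaryFormula p ω).compLinearMap (fun i => g.proj (p i))
  map_add' := by
    intro ω η
    ext a
    simp [coboundaryFormula, insertBracket, Finset.sum_add_distrib,
      mul_add]
  map_smul' := by
    intro c ω
    ext a
    simp [coboundaryFormula, insertBracket, Finset.mul_sum,
      mul_left_comm]

theorem d_apply_of_homogeneous {q : ℕ} (ω : MultilinearMap F (fun _ : Fin q => L) F)
    (p : Fin (q + 1) → ZMod 2) (a : Fin (q + 1) → L) (ha : ∀ i, a i ∈ g.grade (p i)) :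
    g.d q ω a = ∑ s : Fin (q + 1), ∑ r : Fin q with r.castSucc < s,
      (-1 : F) ^ ((s : ℕ) + (p s * ∑ t ∈ Finset.Ioo r.castSucc s, p t).val) *
        ω (Function.update (s.removeNth a) r (g.bracket (a r.castSucc) (a s))) := by
  have hsum : g.d q ω a = g.coboundaryFormula p ω a := by
    change (∑ p : Fin (q + 1) → ZMod 2,
      (g.coboundaryFormula p ω).compLinearMap (fun i => g.proj (p i))) a = _
    rw [sum_apply, Finset.sum_eq_single p]
    · simp [g.proj_same (ha _)]
    · intro p' _ hp'
      obtain ⟨i, hi⟩ := Function.ne_iff.1 hp'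
      rw [MultilinearMap.compLinearMap_apply]
      exact MultilinearMap.map_coord_zero _ i (g.proj_other hi (ha i))
    · simp
  rw [hsum, coboundaryFormula, sum_apply]
  refine Finset.sum_congr rfl fun s _ => ?_
  rw [sum_apply]
  refine Finset.sum_congr rfl fun r hr => ?_
  have hrs : s.succAbove r = r.castSucc :=
    Fin.succAbove_of_castSucc_lt _ _ (Finset.mem_filter.1 hr).2
  simp [insertBracket, Fin.removeNth_apply, hrs]

/-- The `q`-cocycles: cochains killed by the coboundary operator. -/
def cocycles (q : ℕ) : Submodule F (MultilinearMap F (fun _ : Fin q => L) F) :=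
  g.cochains q ⊓ LinearMap.ker (g.d q)

/-- The `q`-coboundaries: images of `(q-1)`-cochains (zero for `q = 0`). -/
def coboundaries : (q : ℕ) → Submodule F (MultilinearMap F (fun _ : Fin q => L) F)
  | 0 => ⊥
  | q + 1 => (g.cochains q).map (g.d q)

/-- The `q`-th cohomology with trivial coefficients, `H^q(g) = Z^q(g) / B^q(g)`. -/
abbrev Cohomology (q : ℕ) : Type _ :=
  Subquotient (g.cocycles q) (g.coboundaries q)

end LieSuperalgebra

/-- The Heisenberg Lie superalgebra with odd center. The element `(u, v, c)` stands for
`∑ u_i x_i + ∑ v_i y_i + c z`; the `x_i` are even, the `y_i` and `z` are odd, and the nonzero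
brackets of basis elements are `[x_i, y_i] = z = -[y_i, x_i]`. -/
def heisenbergOdd (F : Type*) [Field F] (n : ℕ) :
    LieSuperalgebra F ((Fin n → F) × ((Fin n → F) × F)) where
  grade i := if i = 0 then LinearMap.ker (LinearMap.snd F (Fin n → F) ((Fin n → F) × F))
    else LinearMap.ker (LinearMap.fst F (Fin n → F) ((Fin n → F) × F))
  isCompl_grade := by
    rw [if_pos rfl, if_neg one_ne_zero, ← LinearMap.range_inl, ← LinearMap.range_inr]
    exact LinearMap.isCompl_range_inl_inr
  bracket := LinearMap.mk₂ F
    (fun a b => (0, 0, ∑ i, (a.1 i * b.2.1 i - a.2.1 i * b.1 i)))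
    (by
      intro a a' b
      simp only [Prod.mk_add_mk, add_zero, ← Finset.sum_add_distrib, Prod.fst_add, Prod.snd_add,
        Pi.add_apply]
      congr 2
      exact Finset.sum_congr rfl fun i _ => by ring)
    (by
      intro c a b
      simp only [Prod.smul_mk, smul_zero, Prod.smul_fst, Prod.smul_snd,
        Pi.smul_apply, smul_eq_mul]
      congr 2
      rw [Finset.mul_sum]
      exact Finset.sum_congr rfl fun i _ => by ring)
    (by
      intro a b b'
      simp only [Prod.mk_add_mk, add_zero, ← Finset.sum_add_distrib, Prod.fst_add, Prod.snd_add,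
        Pi.add_apply]
      congr 2
      exact Finset.sum_congr rfl fun i _ => by ring)
    (by
      intro c a b
      simp only [Prod.smul_mk, smul_zero, Prod.smul_fst, Prod.smul_snd,
        Pi.smul_apply, smul_eq_mul]
      congr 2
      rw [Finset.mul_sum]
      exact Finset.sum_congr rfl fun i _ => by ring)
  bracket_mem := by
    intro i j a b ha hb
    have h2 : (1 : ZMod 2) + 1 = 0 := by decide
    obtain rfl | rfl : i = 0 ∨ i = 1 := by clear ha; revert i; decide
    all_goals obtain rfl | rfl : j = 0 ∨ j = 1 := by clear hb; revert j; decide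
    all_goals simp_all
  bracket_skew := by
    intro i j a b ha hb
    obtain rfl | rfl : i = 0 ∨ i = 1 := by clear ha; revert i; decide
    all_goals obtain rfl | rfl : j = 0 ∨ j = 1 := by clear hb; revert j; decide
    all_goals simp_all [mul_comm]
  jacobi := by
    intro i j k a b c _ _ _
    simp

/-- `symDim F m p` is the dimension of the `p`-th symmetric power of an `m`-dimensional vector space
over `F` (the degree `p` part of the symmetric algebra of `F^m`), and `0` for `p < 0`. -/
def symDim (F : Type*) [Field F] (m : ℕ) (p : ℤ) : ℤ :=
  if p < 0 then 0
  else (Module.finrank F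
    ↥(LinearMap.range (SymmetricAlgebra.ι F (Fin m → F)) ^ p.toNat) : ℤ)

end

/-! Let ξ_i, η_i, ζ be the coordinates dual to x_i, y_i, z. Since the x_i are even and the other
basis elements odd, the q-cochains are the degree q part of Λ(ξ) ⊗ Γ(η, ζ), an exterior algebra
times a divided power algebra. As every bracket is a multiple of z, the coboundary becomes d = -ω
∂/∂ζ with ω = ∑ ξ_i η_i (`d_koszulCochain`).

The operator ∂/∂ζ maps degree q+1 onto degree q and commutes with ω. Hence B^0 = B^1 = 0, and
B^(q+2) has the dimension σ(q) of ω · (degree q). With c(q), the coefficient of t^q in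
(1+t)^n/(1-t)^(n+1), as the dimension of the q-cochains, this gives dim H^q = c(q) - σ(q-1) -
σ(q-2), where σ vanishes at negative arguments.

The ranks σ come from a Koszul homotopy. The contraction ∑ ∂/∂ξ_j ∂/∂η_j satisfies a Laplace
identity with multiplication by ω (`koszulMul_koszulContr`): their anticommutator multiplies a
monomial by the number of its η's plus the number of its missing ξ's. In characteristic zero this is
invertible except on ξ_1⋯ξ_n ζ^(k). So the cohomology of ω is a line in each degree q ≥ n and zero
below, and σ(q+2) + σ(q) = c(q+2) - [n ≤ q+2] (`koszulRank_add_two`).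

What remains is arithmetic: the recursion for σ determines dim H^(q+4) - dim H^q, and the stated
formula has the same differences and the same initial values (`eq_cohomologyDim`). -/

noncomputable section

/-! ### Dimensions of symmetric powers -/

/-- The symmetric algebra is a polynomial ring, in which the p-th power of the linear forms is the
space of forms of degree p; its monomials are multisets of size p. -/
theorem finrank_range_ι_pow (F : Type*) [Field F] (m p : ℕ) :
    Module.finrank F ↥(LinearMap.range (SymmetricAlgebra.ι F (Fin m → F)) ^ p) =
      m.multichoose p := by
  set e := SymmetricAlgebra.equivMvPolynomial (Pi.basisFun F (Fin m)) with he
  have h1 : (LinearMap.range (SymmetricAlgebra.ι F (Fin m → F))).map e.toAlgHom.toLinearMap =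
      MvPolynomial.homogeneousSubmodule (Fin m) F 1 := by
    rw [MvPolynomial.homogeneousSubmodule_one_eq_span_X, LinearMap.range_eq_map,
      ← (Pi.basisFun F (Fin m)).span_eq, Submodule.map_span, Submodule.map_span,
      ← Set.range_comp, ← Set.range_comp]
    congr 2
    ext i : 1
    exact SymmetricAlgebra.equivMvPolynomial_ι_apply (Pi.basisFun F (Fin m)) i
  have h2 : (LinearMap.range (SymmetricAlgebra.ι F (Fin m → F)) ^ p).map
      e.toLinearEquiv.toLinearMap = MvPolynomial.homogeneousSubmodule (Fin m) F p := by
    rw [← MvPolynomial.homogeneousSubmodule_one_pow, ← h1]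
    exact Submodule.map_pow (LinearMap.range (SymmetricAlgebra.ι F (Fin m → F))) (n := p) e.toAlgHom
  rw [← LinearEquiv.finrank_map_eq e.toLinearEquiv, h2]
  have h3 : Nat.card {d : Fin m →₀ ℕ | d.degree = p} = m.multichoose p := by
    have hcard := Sym.card_sym_eq_multichoose (Fin m) p
    rw [Fintype.card_fin] at hcard
    rw [← hcard]
    refine (Nat.card_congr (Equiv.subtypeEquiv (p := fun d : Fin m →₀ ℕ => d.degree = p)
      (q := fun s : Multiset (Fin m) => s.card = p) Finsupp.orderIsoMultiset.toEquiv
      fun d => ?_)).trans (Nat.card_eq_fintype_card (α := Sym (Fin m) p))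
    simp [Finsupp.degree_eq_sum, Finsupp.card_toMultiset, Finsupp.sum_fintype]
  rw [← h3, MvPolynomial.homogeneousSubmodule_eq_finsupp_supported]
  exact Module.finrank_eq_nat_card_basis (MvPolynomial.basisRestrictSupport F _)

theorem symDim_natCast (F : Type*) [Field F] (m p : ℕ) :
    symDim F m p = m.multichoose p := by
  simp [symDim, finrank_range_ι_pow]

theorem symDim_of_neg (F : Type*) [Field F] (m : ℕ) {p : ℤ} (hp : p < 0) :
    symDim F m p = 0 := by
  simp [symDim, hp]

/-! ### Arithmetic of the dimension formula -/

/-- The coefficient of `t ^ q` in `(1 + t) ^ k / (1 - t) ^ n`. -/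
def hilbertCoeff (k n q : ℕ) : ℤ :=
  ∑ p ∈ Finset.range (q + 1), (k.choose (q - p) : ℤ) * n.multichoose p

theorem hilbertCoeff_zero (k n : ℕ) : hilbertCoeff k n 0 = 1 := by
  simp [hilbertCoeff]

theorem hilbertCoeff_succ_left (k n q : ℕ) :
    hilbertCoeff (k + 1) n (q + 1) = hilbertCoeff k n (q + 1) + hilbertCoeff k n q := by
  simp only [hilbertCoeff]
  rw [Finset.sum_range_succ, Finset.sum_range_succ _ (q + 1), add_right_comm,
    ← Finset.sum_add_distrib]
  congr 1
  · refine Finset.sum_congr rfl fun p hp => ?_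
    have : q + 1 - p = (q - p) + 1 := by have := Finset.mem_range.1 hp; omega
    rw [this, Nat.choose_succ_succ]
    push_cast
    ring
  · simp

theorem hilbertCoeff_succ_right (k n q : ℕ) :
    hilbertCoeff k (n + 1) (q + 1) = hilbertCoeff k n (q + 1) + hilbertCoeff k (n + 1) q := by
  simp only [hilbertCoeff]
  rw [Finset.sum_range_succ', Finset.sum_range_succ' _ (q + 1), add_right_comm,
    ← Finset.sum_add_distrib]
  congr 1
  · refine Finset.sum_congr rfl fun p _ => ?_
    rw [Nat.multichoose_succ_succ, Nat.add_sub_add_right]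
    push_cast
    ring
  · simp

/-- The `i`-th summand of the correction term in degree `q`. -/
def correctionTerm (F : Type*) [Field F] (n q i : ℕ) : ℤ :=
  ∑ p ∈ Finset.range (q - 4 * i),
      ((n + 2).choose (q - 4 * i + 1 - p) : ℤ) * symDim F n p
    + ((n : ℤ) + 2) * symDim F n ((q : ℤ) - 4 * i)
    + symDim F n ((q : ℤ) - 4 * i + 1)
    + (if (q : ℤ) - 4 * i + 1 = n then 1 else 0)
    + 2 * (if (q : ℤ) - 4 * i + 2 = n then 1 else 0)
    + (if (q : ℤ) - 4 * i + 3 = n then 1 else 0)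

/-- The term depends on q and i only through q - 4i. This makes the whole formula telescope in steps
of four. -/
theorem correctionTerm_add_four (F : Type*) [Field F] (n q i : ℕ) :
    correctionTerm F n (q + 4) (i + 1) = correctionTerm F n q i := by
  have h1 : q + 4 - 4 * (i + 1) = q - 4 * i := by omega
  have h2 : ((q + 4 : ℕ) : ℤ) - 4 * ((i + 1 : ℕ) : ℤ) = q - 4 * i := by push_cast; ring
  simp only [correctionTerm, h1, h2]

/-- The two separate symmetric powers are the summands p = q and p = q + 1 that complete the
binomial sum to a full coefficient. -/
theorem correctionTerm_zero (F : Type*) [Field F] (n q : ℕ) :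
    correctionTerm F n q 0 = hilbertCoeff (n + 2) n (q + 1)
      + (if q + 1 = n then 1 else 0) + 2 * (if q + 2 = n then 1 else 0)
      + (if q + 3 = n then 1 else 0) := by
  have h1 : symDim F n ((q : ℤ) + 1) = n.multichoose (q + 1) := by
    exact_mod_cast symDim_natCast F n (q + 1)
  have h2 : q + 1 - q = 1 := by omega
  have e1 : ((q : ℤ) + 1 = n) ↔ q + 1 = n := by omega
  have e2 : ((q : ℤ) + 2 = n) ↔ q + 2 = n := by omega
  have e3 : ((q : ℤ) + 3 = n) ↔ q + 3 = n := by omega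
  simp only [correctionTerm, hilbertCoeff, Nat.cast_zero, mul_zero, sub_zero, Nat.sub_zero,
    symDim_natCast, h1, Finset.sum_range_succ _ (q + 1), Finset.sum_range_succ _ q, h2,
    Nat.sub_self, Nat.choose_one_right, Nat.choose_zero_right, e1, e2, e3]
  push_cast
  ring

/-- The right-hand side of the dimension formula. -/
def cohomologyDim (F : Type*) [Field F] (n q : ℕ) : ℤ :=
  ∑ p ∈ Finset.range q, (((n + 1).choose (q - p) : ℤ) * symDim F n p
      - (n.choose (q - 1 - p) : ℤ) * symDim F (n + 1) p)
    + symDim F n q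
    + ∑ i ∈ Finset.Icc 1 (q / 4 + if q % 4 = 2 ∨ q % 4 = 3 then 1 else 0),
        correctionTerm F n q i

theorem mainPart_succ (F : Type*) [Field F] (n q : ℕ) :
    ∑ p ∈ Finset.range (q + 1), (((n + 1).choose (q + 1 - p) : ℤ) * symDim F n p
      - (n.choose (q + 1 - 1 - p) : ℤ) * symDim F (n + 1) p) + symDim F n (q + 1 : ℕ) =
    hilbertCoeff (n + 1) n (q + 1) - hilbertCoeff n (n + 1) q := by
  simp only [hilbertCoeff, symDim_natCast, Finset.sum_sub_distrib, Finset.sum_range_succ _ (q + 1),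
    Nat.sub_self, Nat.choose_zero_right, Nat.add_sub_cancel]
  push_cast
  ring

/-- With P = (1+t)^n/(1-t)^n, the main part has generating function M = P(1 + t - t/(1-t)), and one
new correction term t^3(1+t)^2 P enters. The claim is the identity (1-t^4)M + t^3(1+t)^2 P =
(1-t^2)P, plus the Kronecker deltas. -/
theorem cohomologyDim_add_four (F : Type*) [Field F] (n q : ℕ) :
    cohomologyDim F n (q + 5) - cohomologyDim F n (q + 1) =
      hilbertCoeff n n (q + 5) - hilbertCoeff n n (q + 3)
      + (if q + 2 = n then 1 else 0) + 2 * (if q + 3 = n then 1 else 0)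
      + (if q + 4 = n then 1 else 0) := by
  -- Raising the degree by four adds exactly one correction term; the others cancel against those of
  -- degree q + 1 after a shift of the index.
  have hN : ((q + 5) / 4 + if (q + 5) % 4 = 2 ∨ (q + 5) % 4 = 3 then 1 else 0) =
      ((q + 1) / 4 + if (q + 1) % 4 = 2 ∨ (q + 1) % 4 = 3 then 1 else 0) + 1 := by
    split_ifs <;> omega
  unfold cohomologyDim
  rw [hN, mainPart_succ F n (q + 4), mainPart_succ F n q]
  generalize ((q + 1) / 4 + if (q + 1) % 4 = 2 ∨ (q + 1) % 4 = 3 then 1 else 0) = N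
  have hIcc : ∀ (M : ℕ) (f : ℕ → ℤ),
      ∑ i ∈ Finset.Icc 1 M, f i = ∑ i ∈ Finset.range M, f (i + 1) := by
    intro M f
    rw [Finset.range_eq_Ico, Finset.sum_Ico_add' f 0 M 1]
    rfl
  rw [hIcc, hIcc]
  simp only [correctionTerm_add_four F n (q + 1), Finset.sum_range_succ' _ N]
  rw [correctionTerm_zero]
  simp only [hilbertCoeff_succ_left, hilbertCoeff_succ_right]
  ring

theorem cohomologyDim_zero (F : Type*) [Field F] (n : ℕ) : cohomologyDim F n 0 = 1 := by
  have := symDim_natCast F n 0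
  simp at this
  simp [cohomologyDim, this]

theorem cohomologyDim_one (F : Type*) [Field F] (n : ℕ) :
    cohomologyDim F n 1 = hilbertCoeff n n 1 := by
  unfold cohomologyDim
  rw [mainPart_succ F n 0]
  simp [hilbertCoeff_succ_left, hilbertCoeff_zero]

theorem cohomologyDim_two (F : Type*) [Field F] (n : ℕ) (hn : 1 ≤ n) :
    cohomologyDim F n 2 = hilbertCoeff n n 2 - 1 + if 1 = n then 1 else 0 := by
  unfold cohomologyDim
  rw [mainPart_succ F n 1]
  -- For q = 2 and i = 1 the deltas compare n with -1, 0 and 1, so only the last can contribute.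
  have h0 : (0 : ℤ) ≠ n := by omega
  have h1 : (-1 : ℤ) ≠ n := by omega
  have e : ((1 : ℤ) = n) ↔ 1 = n := by omega
  norm_num [correctionTerm, hilbertCoeff_succ_left, hilbertCoeff_succ_right, hilbertCoeff_zero,
    symDim_of_neg, h0, h1, e]
  ring

theorem cohomologyDim_three (F : Type*) [Field F] (n : ℕ) (hn : 1 ≤ n) :
    cohomologyDim F n 3 = hilbertCoeff n n 3 - hilbertCoeff n n 1
      + 2 * (if 1 = n then 1 else 0) + if 2 = n then 1 else 0 := by
  unfold cohomologyDim
  rw [mainPart_succ F n 2]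
  have h0 : (0 : ℤ) ≠ n := by omega
  have e : ((1 : ℤ) = n) ↔ 1 = n := by omega
  have e2 : ((2 : ℤ) = n) ↔ 2 = n := by omega
  have hs : symDim F n 0 = 1 := by
    have := symDim_natCast F n 0
    simpa using this
  norm_num [correctionTerm, hilbertCoeff_succ_left, hilbertCoeff_succ_right, hilbertCoeff_zero,
    symDim_of_neg, h0, e, e2, hs]
  ring

theorem cohomologyDim_four (F : Type*) [Field F] (n : ℕ) :
    cohomologyDim F n 4 = hilbertCoeff n n 4 - hilbertCoeff n n 2 + 1
      + (if 1 = n then 1 else 0) + 2 * (if 2 = n then 1 else 0)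
      + (if 3 = n then 1 else 0) := by
  unfold cohomologyDim
  rw [mainPart_succ F n 3]
  have hc : correctionTerm F n 4 1 = _ :=
    (correctionTerm_add_four F n 0 0).trans (correctionTerm_zero F n 0)
  norm_num [hc, hilbertCoeff_succ_left, hilbertCoeff_succ_right, hilbertCoeff_zero]
  ring

/-- The dimension formula, in terms of the ranks `σ j` of the multiplication operator. -/
theorem eq_cohomologyDim (F : Type*) [Field F] {n : ℕ} (hn : 1 ≤ n) {h σ : ℕ → ℤ}
    (hσ0 : σ 0 = 1) (hσ1 : σ 1 = hilbertCoeff n (n + 1) 1 - if n ≤ 1 then 1 else 0)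
    (hσ : ∀ q, σ (q + 2) + σ q = hilbertCoeff n (n + 1) (q + 2) - if n ≤ q + 2 then 1 else 0)
    (h0 : h 0 = 1) (h1 : h 1 = hilbertCoeff n (n + 1) 1 - σ 0)
    (hh : ∀ q, h (q + 2) = hilbertCoeff n (n + 1) (q + 2) - σ (q + 1) - σ q) (q : ℕ) :
    h q = cohomologyDim F n q := by
  have h2 : h 2 = hilbertCoeff n n 2 - 1 + if 1 = n then 1 else 0 := by
    have : (if n ≤ 1 then (1 : ℤ) else 0) = if 1 = n then 1 else 0 := by
      split_ifs <;> omega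
    rw [hh, hσ1, hσ0, this]
    simp only [hilbertCoeff_succ_right]
    ring
  -- In the sum the ranks pair up as σ(q+3) + σ(q+1) and σ(q+2) + σ(q), which `hσ` eliminates.
  have hrec : ∀ q, h (q + 4) + h (q + 2) = hilbertCoeff n n (q + 4)
      + (if n ≤ q + 3 then 1 else 0) + (if n ≤ q + 2 then 1 else 0) := by
    intro q
    have e1 := hh (q + 2)
    have e2 := hh q
    have e3 := hσ q
    have e4 := hσ (q + 1)
    have e5 := hilbertCoeff_succ_right n n (q + 3)
    simp only [add_assoc, Nat.reduceAdd] at *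
    linarith
  have h3 : h 3 = hilbertCoeff n n 3 - hilbertCoeff n n 1
      + 2 * (if 1 = n then 1 else 0) + if 2 = n then 1 else 0 := by
    have e1 := hh 1
    have e2 := hσ 0
    have e3 : (if n ≤ 2 then (1 : ℤ) else 0) = (if 1 = n then 1 else 0) + if 2 = n then 1 else 0 := by
      split_ifs <;> omega
    have e4 : (if n ≤ 1 then (1 : ℤ) else 0) = if 1 = n then 1 else 0 := by
      split_ifs <;> omega
    simp only [Nat.reduceAdd, zero_add, hilbertCoeff_succ_right, hilbertCoeff_zero, e3, e4] at *
    linarith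
  have h4 : h 4 = hilbertCoeff n n 4 - hilbertCoeff n n 2 + 1
      + (if 1 = n then 1 else 0) + 2 * (if 2 = n then 1 else 0)
      + (if 3 = n then 1 else 0) := by
    have e1 := hrec 0
    have e2 : (if n ≤ 2 then (1 : ℤ) else 0) = (if 1 = n then 1 else 0) + if 2 = n then 1 else 0 := by
      split_ifs <;> omega
    have e3 : (if n ≤ 3 then (1 : ℤ) else 0) = (if 1 = n then 1 else 0) + (if 2 = n then 1 else 0)
        + if 3 = n then 1 else 0 := by
      split_ifs <;> omega
    simp only [zero_add, e2, e3] at e1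
    linarith
  -- Two instances of `hrec` two degrees apart are subtracted. As `hrec` starts with h 4 + h 2, the
  -- case q = 0 uses the explicit h 1 and h 3 instead.
  have hstep : ∀ q, h (q + 5) - h (q + 1) = cohomologyDim F n (q + 5) - cohomologyDim F n (q + 1) := by
    intro q
    rw [cohomologyDim_add_four]
    rcases q with _ | q
    · have e1 := hrec 1
      have e2 : (if n ≤ 4 then (1 : ℤ) else 0) + (if n ≤ 3 then 1 else 0) =
          2 * (if 1 = n then 1 else 0) + 2 * (if 2 = n then 1 else 0)
          + 2 * (if 3 = n then 1 else 0) + if 4 = n then 1 else 0 := by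
        split_ifs <;> omega
      have h1' : h 1 = hilbertCoeff n n 1 := by
        rw [h1, hσ0, hilbertCoeff_succ_right, hilbertCoeff_zero]; ring
      simp only [Nat.reduceAdd, zero_add] at *
      linarith
    · have e1 := hrec (q + 2)
      have e2 := hrec q
      have e3 : (if n ≤ q + 5 then (1 : ℤ) else 0) + (if n ≤ q + 4 then 1 else 0) =
          (if n ≤ q + 3 then 1 else 0) + (if n ≤ q + 2 then 1 else 0)
          + (if q + 3 = n then 1 else 0) + 2 * (if q + 4 = n then 1 else 0)
          + if q + 5 = n then 1 else 0 := by
        split_ifs <;> omega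
      simp only [add_assoc, Nat.reduceAdd] at *
      linarith
  induction q using Nat.strong_induction_on with
  | _ q ih =>
    match q with
    | 0 => rw [h0, cohomologyDim_zero]
    | 1 => rw [cohomologyDim_one, h1, hσ0, hilbertCoeff_succ_right, hilbertCoeff_zero]; ring
    | 2 => rw [cohomologyDim_two F n hn, h2]
    | 3 => rw [cohomologyDim_three F n hn, h3]
    | 4 => rw [cohomologyDim_four, h4]
    | q + 5 =>
      have := ih (q + 1) (by omega)
      have := hstep q
      linarith

/-! ### The Koszul operator ω = ∑ ξ_i η_i and its homotopy -/

section Koszul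

open Finset

variable {F : Type*} [Field F] {n : ℕ}

/-- The sign of moving the factor `i` of a wedge product over `S` to the front. -/
def wedgeSign (F : Type*) [Field F] {n : ℕ} (S : Finset (Fin n)) (i : Fin n) : F :=
  (-1) ^ #{j ∈ S | j < i}

theorem wedgeSign_mul_self (S : Finset (Fin n)) (i : Fin n) :
    wedgeSign F S i * wedgeSign F S i = 1 := by
  rw [wedgeSign, ← mul_pow]
  simp

theorem wedgeSign_insert {S : Finset (Fin n)} {j : Fin n} (hj : j ∉ S) (i : Fin n) :
    wedgeSign F (insert j S) i = (if j < i then -1 else 1) * wedgeSign F S i := by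
  unfold wedgeSign
  rw [filter_insert]
  split_ifs with h
  · rw [card_insert_of_notMem (by simp [hj]), pow_succ]
    ring
  · rw [one_mul]

theorem wedgeSign_erase {S : Finset (Fin n)} {i : Fin n} (hi : i ∈ S) (j : Fin n) :
    wedgeSign F (S.erase i) j = (if i < j then -1 else 1) * wedgeSign F S j := by
  conv_rhs => rw [← insert_erase hi, wedgeSign_insert (notMem_erase i S)]
  split_ifs <;> ring

/-- Multiplication by ξ_i anticommutes with ∂/∂ξ_j for i ≠ j; this cancels the cross terms of the
Laplacian. -/
theorem wedgeSign_mul_erase {S : Finset (Fin n)} {i j : Fin n} (hi : i ∈ S) (hj : j ∉ S) :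
    wedgeSign F S i * wedgeSign F (S.erase i) j =
      -(wedgeSign F S j * wedgeSign F (insert j S) i) := by
  rw [wedgeSign_erase hi, wedgeSign_insert hj]
  have hij : i ≠ j := by rintro rfl; exact hj hi
  rcases lt_or_gt_of_ne hij with h | h
  · simp [h, h.not_gt, mul_comm]
  · simp [h, h.not_gt, mul_comm]

theorem wedgeSign_mul_erase_comm {S : Finset (Fin n)} {i j : Fin n} (hi : i ∈ S) (hj : j ∈ S)
    (hij : i ≠ j) :
    wedgeSign F S i * wedgeSign F (S.erase i) j =
      -(wedgeSign F S j * wedgeSign F (S.erase j) i) := by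
  rw [wedgeSign_erase hi, wedgeSign_erase hj]
  rcases lt_or_gt_of_ne hij with h | h
  · simp [h, h.not_gt, mul_comm]
  · simp [h, h.not_gt, mul_comm]

/-- Coefficient functions of elements of `Λ(ξ₁, …, ξₙ) ⊗ Γ(η₁, …, ηₙ, ζ)` in the monomial basis
(divided powers in the second factor; `none` stands for `ζ`). -/
abbrev KoszulSpace (F : Type*) (n : ℕ) : Type _ :=
  Finset (Fin n) → Multiset (Option (Fin n)) → F

/-- Multiplication by `∑ ξᵢ ηᵢ`. -/
def koszulMul (F : Type*) [Field F] (n : ℕ) : KoszulSpace F n →ₗ[F] KoszulSpace F n where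
  toFun G S μ := ∑ i ∈ S, wedgeSign F S i * (μ.count (some i) *
    G (S.erase i) (μ.erase (some i)))
  map_add' G H := by
    ext S μ
    simp [mul_add, sum_add_distrib]
  map_smul' c G := by
    ext S μ
    simp [mul_left_comm, mul_sum]

theorem koszulMul_apply (G : KoszulSpace F n) (S : Finset (Fin n))
    (μ : Multiset (Option (Fin n))) :
    koszulMul F n G S μ = ∑ i ∈ S, wedgeSign F S i * (μ.count (some i) *
      G (S.erase i) (μ.erase (some i))) := rfl

/-- The contraction `∑ ∂/∂ξᵢ ∂/∂ηᵢ`. -/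
def koszulContr (F : Type*) [Field F] (n : ℕ) : KoszulSpace F n →ₗ[F] KoszulSpace F n where
  toFun G S μ := ∑ j ∈ Sᶜ, wedgeSign F S j * G (insert j S) (some j ::ₘ μ)
  map_add' G H := by
    ext S μ
    simp [mul_add, sum_add_distrib]
  map_smul' c G := by
    ext S μ
    simp [mul_left_comm, mul_sum]

theorem koszulContr_apply (G : KoszulSpace F n) (S : Finset (Fin n))
    (μ : Multiset (Option (Fin n))) :
    koszulContr F n G S μ = ∑ j ∈ Sᶜ, wedgeSign F S j * G (insert j S) (some j ::ₘ μ) := rfl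

/-- The eigenvalue of the Laplacian of the Koszul operator. -/
def koszulWeight (S : Finset (Fin n)) (μ : Multiset (Option (Fin n))) : ℕ :=
  ∑ i, μ.count (some i) + #Sᶜ

/-- The ξ's anticommute and the η's commute, so exchanging the two summation indices negates the
double sum. -/
theorem koszulMul_koszulMul [CharZero F] (G : KoszulSpace F n) :
    koszulMul F n (koszulMul F n G) = 0 := by
  ext S μ
  have key : ∀ i ∈ S, ∀ j ∈ S.erase i,
      wedgeSign F S i * (μ.count (some i) * (wedgeSign F (S.erase i) j *
        ((μ.erase (some i)).count (some j) *
          G ((S.erase i).erase j) ((μ.erase (some i)).erase (some j))))) =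
      -(wedgeSign F S j * (μ.count (some j) * (wedgeSign F (S.erase j) i *
        ((μ.erase (some j)).count (some i) *
          G ((S.erase j).erase i) ((μ.erase (some j)).erase (some i)))))) := by
    intro i hi j hj
    obtain ⟨hji, hj⟩ := mem_erase.1 hj
    rw [Multiset.count_erase_of_ne (by simpa using hji),
      Multiset.count_erase_of_ne (by simpa using hji.symm), erase_right_comm,
      Multiset.erase_comm]
    linear_combination ((μ.count (some i) : F) * μ.count (some j) *
      G ((S.erase j).erase i) ((μ.erase (some j)).erase (some i))) *
        wedgeSign_mul_erase_comm (F := F) hi hj hji.symm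
  have h2 : koszulMul F n (koszulMul F n G) S μ = -koszulMul F n (koszulMul F n G) S μ := by
    simp only [koszulMul_apply, mul_sum]
    conv_lhs => rw [sum_congr rfl fun i hi => sum_congr rfl fun j hj => key i hi j hj]
    simp only [sum_neg_distrib]
    rw [neg_inj]
    refine sum_comm' fun i j => ?_
    simp only [mem_erase]
    tauto
  simpa using self_eq_neg.1 h2

/-- The cross terms i ≠ j cancel. Of the diagonal ones, each i ∈ S contributes its multiplicity in
μ, and each j ∉ S its multiplicity plus one, from η_j being multiplied in before differentiating. -/
theorem koszulMul_koszulContr (G : KoszulSpace F n) (S : Finset (Fin n))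
    (μ : Multiset (Option (Fin n))) :
    koszulMul F n (koszulContr F n G) S μ + koszulContr F n (koszulMul F n G) S μ =
      koszulWeight S μ * G S μ := by
  have h1 : koszulMul F n (koszulContr F n G) S μ = ∑ i ∈ S, μ.count (some i) * G S μ +
      ∑ i ∈ S, ∑ j ∈ Sᶜ, wedgeSign F S i * wedgeSign F (S.erase i) j * (μ.count (some i) *
        G (insert j (S.erase i)) (some j ::ₘ μ.erase (some i))) := by
    rw [koszulMul_apply, ← sum_add_distrib]
    refine sum_congr rfl fun i hi => ?_
    rw [koszulContr_apply, compl_erase, sum_insert (by simpa using hi), insert_erase hi,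
      wedgeSign_erase hi, mul_add, mul_add, mul_sum, mul_sum]
    congr 1
    · by_cases hμ : some i ∈ μ
      · rw [Multiset.cons_erase hμ]
        simp only [lt_irrefl, if_false, one_mul]
        linear_combination (μ.count (some i) * G S μ) * wedgeSign_mul_self (F := F) S i
      · simp [Multiset.count_eq_zero_of_notMem hμ]
    · refine sum_congr rfl fun j _ => ?_
      ring
  have h2 : koszulContr F n (koszulMul F n G) S μ =
      ∑ j ∈ Sᶜ, ((μ.count (some j) : F) + 1) * G S μ +
      ∑ j ∈ Sᶜ, ∑ i ∈ S, wedgeSign F S j * wedgeSign F (insert j S) i * (μ.count (some i) *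
        G (insert j (S.erase i)) (some j ::ₘ μ.erase (some i))) := by
    rw [koszulContr_apply, ← sum_add_distrib]
    refine sum_congr rfl fun j hj => ?_
    have hj' : j ∉ S := by simpa using hj
    rw [koszulMul_apply, sum_insert hj', erase_insert hj', wedgeSign_insert hj',
      Multiset.erase_cons_head, Multiset.count_cons_self, mul_add, mul_sum]
    congr 1
    · simp only [lt_irrefl, if_false, one_mul]
      push_cast
      linear_combination (((μ.count (some j) : F) + 1) * G S μ) * wedgeSign_mul_self (F := F) S j
    · refine sum_congr rfl fun i hi => ?_
      have hij : i ≠ j := by rintro rfl; exact hj' hi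
      rw [Multiset.count_cons_of_ne (by simpa using hij),
        Multiset.erase_cons_tail _ (by simpa using hij.symm), erase_insert_of_ne hij.symm]
      ring
  rw [h1, h2, sum_comm (s := Sᶜ)]
  have h3 : ∀ i ∈ S, ∀ j ∈ Sᶜ, wedgeSign F S i * wedgeSign F (S.erase i) j * (μ.count (some i) *
        G (insert j (S.erase i)) (some j ::ₘ μ.erase (some i))) =
      -(wedgeSign F S j * wedgeSign F (insert j S) i * (μ.count (some i) *
        G (insert j (S.erase i)) (some j ::ₘ μ.erase (some i)))) := by
    intro i hi j hj
    rw [wedgeSign_mul_erase hi (by simpa using hj)]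
    ring
  rw [sum_congr rfl fun i hi => sum_congr rfl fun j hj => h3 i hi j hj]
  simp only [sum_neg_distrib, add_mul, sum_add_distrib, one_mul]
  rw [koszulWeight, ← sum_add_sum_compl S]
  push_cast
  rw [add_mul, add_mul, sum_mul, sum_mul, sum_const, nsmul_eq_mul]
  ring

/-- The homogeneous component of degree `q`. -/
def koszulDeg (F : Type*) [Field F] (n q : ℕ) : Submodule F (KoszulSpace F n) where
  carrier := {G | ∀ S μ, S.card + Multiset.card μ ≠ q → G S μ = 0}
  add_mem' hG hH S μ h := by simp [hG S μ h, hH S μ h]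
  zero_mem' S μ _ := rfl
  smul_mem' c G hG S μ h := by simp [hG S μ h]

theorem koszulMul_mem {q : ℕ} {G : KoszulSpace F n} (hG : G ∈ koszulDeg F n q) :
    koszulMul F n G ∈ koszulDeg F n (q + 2) := by
  intro S μ h
  rw [koszulMul_apply]
  refine sum_eq_zero fun i hi => ?_
  by_cases hμ : some i ∈ μ
  · have h1 := card_erase_add_one hi
    have h2 := Multiset.card_erase_add_one hμ
    rw [hG _ _ (by omega), mul_zero, mul_zero]
  · simp [Multiset.count_eq_zero_of_notMem hμ]

theorem koszulContr_mem {q : ℕ} {G : KoszulSpace F n} (hG : G ∈ koszulDeg F n (q + 2)) :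
    koszulContr F n G ∈ koszulDeg F n q := by
  intro S μ h
  rw [koszulContr_apply]
  refine sum_eq_zero fun j hj => ?_
  rw [hG _ _ (by rw [card_insert_of_notMem (by simpa using hj), Multiset.card_cons]; omega),
    mul_zero]

theorem koszulContr_eq_zero {q : ℕ} (hq : q < 2) {G : KoszulSpace F n}
    (hG : G ∈ koszulDeg F n q) : koszulContr F n G = 0 := by
  ext S μ
  rw [koszulContr_apply]
  refine sum_eq_zero fun j hj => ?_
  rw [hG _ _ (by rw [card_insert_of_notMem (by simpa using hj), Multiset.card_cons]; omega),
    mul_zero]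

/-- Multiplication by ξ_i η_i trades a missing ξ for an extra η. Hence dividing by the weight
commutes with the Koszul operator. -/
theorem koszulWeight_erase {S : Finset (Fin n)} {μ : Multiset (Option (Fin n))} {i : Fin n}
    (hi : i ∈ S) (hμ : some i ∈ μ) :
    koszulWeight (S.erase i) (μ.erase (some i)) = koszulWeight S μ := by
  unfold koszulWeight
  rw [compl_erase, card_insert_of_notMem (by simpa using hi)]
  have h : ∀ ν : Multiset (Option (Fin n)),
      ∑ k, (some i ::ₘ ν).count (some k) = ∑ k, ν.count (some k) + 1 := by
    intro ν
    simp [Multiset.count_cons, sum_add_distrib]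
  conv_rhs => rw [← Multiset.cons_erase hμ, h]
  ring

theorem eq_replicate_of_koszulWeight_eq_zero {S : Finset (Fin n)} {μ : Multiset (Option (Fin n))}
    (h : koszulWeight S μ = 0) : S = univ ∧ μ = Multiset.replicate (Multiset.card μ) none := by
  unfold koszulWeight at h
  obtain ⟨h1, h2⟩ := Nat.add_eq_zero_iff.1 h
  refine ⟨by simpa using h2, Multiset.eq_replicate_card.2 fun b hb => ?_⟩
  rcases b with _ | i
  · rfl
  · exact absurd hb (Multiset.count_eq_zero.1 (sum_eq_zero_iff.1 h1 i (mem_univ i)))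

/-- The primitive of a closed element given by the homotopy. -/
theorem koszulMul_div [CharZero F] {q : ℕ} {G : KoszulSpace F n} (hG : G ∈ koszulDeg F n q)
    (hω : koszulMul F n G = 0) (hev : G univ (Multiset.replicate (q - n) none) = 0) :
    koszulMul F n (fun S μ => koszulContr F n G S μ / koszulWeight S μ) = G := by
  ext S μ
  have h1 : koszulMul F n (fun S μ => koszulContr F n G S μ / koszulWeight S μ) S μ =
      koszulMul F n (koszulContr F n G) S μ / koszulWeight S μ := by
    rw [koszulMul_apply, koszulMul_apply, sum_div]
    refine sum_congr rfl fun i hi => ?_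
    by_cases hμ : some i ∈ μ
    · rw [koszulWeight_erase hi hμ]
      ring
    · simp [Multiset.count_eq_zero_of_notMem hμ]
  have h2 := koszulMul_koszulContr G S μ
  rw [hω, map_zero, Pi.zero_apply, Pi.zero_apply, add_zero] at h2
  rw [h1, h2]
  -- At weight zero the quotient is 0 by convention, so G itself must vanish there; this is what
  -- `hev` provides.
  rcases eq_or_ne (koszulWeight S μ) 0 with h | h
  · obtain ⟨hS, hμ⟩ := eq_replicate_of_koszulWeight_eq_zero h
    rw [h, Nat.cast_zero, zero_mul, zero_div]
    by_cases hd : S.card + Multiset.card μ = q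
    · have : Multiset.card μ = q - n := by
        rw [hS, card_univ, Fintype.card_fin] at hd
        omega
      rw [hS, hμ, this, hev]
    · rw [hG S μ hd]
  · rw [mul_div_cancel_left₀ _ (Nat.cast_ne_zero.2 h)]

/-- Every monomial in the image contains some η_i, while the top monomial ξ_1⋯ξ_n ζ^(k) contains
none. -/
theorem koszulMul_top (G : KoszulSpace F n) (k : ℕ) :
    koszulMul F n G univ (Multiset.replicate k none) = 0 := by
  rw [koszulMul_apply]
  refine sum_eq_zero fun i _ => ?_
  rw [Multiset.count_eq_zero_of_notMem (by simp [Multiset.mem_replicate])]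
  simp

/-- The shift `∂/∂ζ`. -/
def koszulShift (F : Type*) [Field F] (n : ℕ) : KoszulSpace F n →ₗ[F] KoszulSpace F n where
  toFun G S μ := G S (none ::ₘ μ)
  map_add' _ _ := rfl
  map_smul' _ _ := rfl

theorem map_koszulShift (q : ℕ) :
    (koszulDeg F n (q + 1)).map (koszulShift F n) = koszulDeg F n q := by
  apply le_antisymm
  · rintro _ ⟨G, hG, rfl⟩ S μ h
    exact hG _ _ (by rw [Multiset.card_cons]; omega)
  · intro G hG
    -- The preimage raises each ζ^(k) to ζ^(k+1), an exact antiderivative in the divided power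
    -- basis.
    refine ⟨fun S μ => if none ∈ μ then G S (μ.erase none) else 0, fun S μ h => ?_, ?_⟩
    · dsimp only
      split_ifs with h'
      · have := Multiset.card_erase_add_one h'
        exact hG _ _ (by omega)
      · rfl
    · ext S μ
      simp [koszulShift]

theorem map_koszulShift_zero : (koszulDeg F n 0).map (koszulShift F n) = ⊥ := by
  rw [eq_bot_iff]
  rintro _ ⟨G, hG, rfl⟩
  rw [Submodule.mem_bot]
  ext S μ
  exact hG _ _ (by rw [Multiset.card_cons]; omega)

/-! ### Dimensions and ranks in the Koszul complex -/

/-- The indices of monomials of degree `q`. -/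
abbrev KoszulIndex (n q : ℕ) : Type :=
  {p : Finset (Fin n) × Multiset (Option (Fin n)) // p.1.card + Multiset.card p.2 = q}

def koszulIndexEquiv (n q : ℕ) : KoszulIndex n q ≃
    Σ p : Fin (q + 1), {S : Finset (Fin n) // S.card = q - p} × Sym (Option (Fin n)) p where
  toFun s := ⟨⟨Multiset.card s.1.2, by have := s.2; omega⟩,
    ⟨s.1.1, by have := s.2; dsimp only; omega⟩, ⟨s.1.2, rfl⟩⟩
  invFun s := ⟨(s.2.1.1, s.2.2.1), by
    have h1 := s.2.1.2
    have h2 := s.2.2.2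
    have h3 := s.1.2
    dsimp only
    omega⟩
  left_inv s := rfl
  right_inv := by
    rintro ⟨⟨p, hp⟩, ⟨S, hS⟩, ⟨μ, hμ⟩⟩
    change Multiset.card μ = p at hμ
    subst hμ
    rfl

instance (n q : ℕ) : Finite (KoszulIndex n q) :=
  Finite.of_equiv _ (koszulIndexEquiv n q).symm

theorem card_koszulIndex (n q : ℕ) :
    (Nat.card (KoszulIndex n q) : ℤ) = hilbertCoeff n (n + 1) q := by
  rw [Nat.card_congr (koszulIndexEquiv n q), Nat.card_sigma, hilbertCoeff,
    ← Fin.sum_univ_eq_sum_range (fun p => (n.choose (q - p) : ℤ) * (n + 1).multichoose p)]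
  push_cast
  refine sum_congr rfl fun p _ => ?_
  rw [Nat.card_prod, Nat.card_eq_fintype_card, Nat.card_eq_fintype_card, Fintype.card_finset_len,
    Sym.card_sym_eq_multichoose, Fintype.card_option, Fintype.card_fin]
  push_cast
  rfl

/-- Homogeneous elements are functions on the monomials of their degree. -/
def koszulDegEquiv (F : Type*) [Field F] (n q : ℕ) : koszulDeg F n q ≃ₗ[F] (KoszulIndex n q → F) where
  toFun G s := G.1 s.1.1 s.1.2
  map_add' _ _ := rfl
  map_smul' _ _ := rfl
  invFun f := ⟨fun S μ => if h : S.card + Multiset.card μ = q then f ⟨(S, μ), h⟩ else 0,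
    fun S μ h => dif_neg h⟩
  left_inv G := by
    ext S μ
    dsimp only
    split_ifs with h
    · rfl
    · exact (G.2 S μ h).symm
  right_inv f := by
    ext s
    exact dif_pos s.2

instance (q : ℕ) : Module.Finite F (koszulDeg F n q) :=
  Module.Finite.equiv (koszulDegEquiv F n q).symm

theorem finrank_koszulDeg (q : ℕ) :
    (Module.finrank F (koszulDeg F n q) : ℤ) = hilbertCoeff n (n + 1) q := by
  have : Fintype (KoszulIndex n q) := Fintype.ofFinite _
  rw [LinearEquiv.finrank_eq (koszulDegEquiv F n q), Module.finrank_fintype_fun_eq_card,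
    ← Nat.card_eq_fintype_card, card_koszulIndex]

theorem finrank_map_add_finrank_inf_ker {V W : Type*} [AddCommGroup V] [Module F V]
    [AddCommGroup W] [Module F W] (p : Submodule F V) [Module.Finite F p] (f : V →ₗ[F] W) :
    Module.finrank F (p.map f) + Module.finrank F ↥(p ⊓ LinearMap.ker f) =
      Module.finrank F p := by
  rw [← LinearMap.finrank_range_add_finrank_ker (f.domRestrict p), LinearMap.range_domRestrict]
  congr 1
  have : LinearMap.ker (f.domRestrict p) = (LinearMap.ker f).comap p.subtype := rfl
  rw [this, ← Submodule.map_comap_subtype]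
  exact (Submodule.equivMapOfInjective p.subtype p.subtype_injective _).finrank_eq.symm

/-- The rank of the Koszul operator in degree `q`. -/
def koszulRank (F : Type*) [Field F] (n q : ℕ) : ℤ :=
  Module.finrank F ((koszulDeg F n q).map (koszulMul F n))

/-- Evaluation at the top monomial. -/
def koszulTop (F : Type*) [Field F] (n k : ℕ) : KoszulSpace F n →ₗ[F] F where
  toFun G := G univ (Multiset.replicate k none)
  map_add' _ _ := rfl
  map_smul' _ _ := rfl

theorem finrank_map_koszulTop (q : ℕ) :
    Module.finrank F
      ((koszulDeg F n q ⊓ LinearMap.ker (koszulMul F n)).map (koszulTop F n (q - n))) =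
      if n ≤ q then 1 else 0 := by
  split_ifs with h
  · rw [(?_ : Submodule.map _ _ = ⊤), finrank_top, Module.finrank_self]
    rw [eq_top_iff]
    intro c _
    -- The witness is c times the top monomial, which ω kills because it already contains every ξ_i.
    refine ⟨fun S μ => if S = univ ∧ μ = Multiset.replicate (q - n) none then c else 0,
      ⟨fun S μ hd => if_neg ?_, ?_⟩, if_pos ⟨rfl, rfl⟩⟩
    · rintro ⟨rfl, rfl⟩
      simp at hd
      omega
    · refine LinearMap.mem_ker.2 ?_
      ext S μ
      rw [koszulMul_apply]
      refine sum_eq_zero fun i hi => ?_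
      rw [if_neg, mul_zero, mul_zero]
      rintro ⟨h1, -⟩
      exact notMem_erase i S (h1 ▸ mem_univ i)
  · rw [(?_ : Submodule.map _ _ = ⊥), finrank_bot]
    rw [eq_bot_iff]
    -- For q < n the evaluated monomial has degree n ≠ q, so homogeneous elements of degree q vanish
    -- on it.
    rintro _ ⟨G, ⟨hG, -⟩, rfl⟩
    exact hG _ _ (by simp; omega)

theorem finrank_koszulDeg_inf_ker (q : ℕ) :
    (Module.finrank F ↥(koszulDeg F n q ⊓ LinearMap.ker (koszulMul F n)) : ℤ) =
      hilbertCoeff n (n + 1) q - koszulRank F n q := by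
  rw [← finrank_koszulDeg (F := F), koszulRank,
    ← finrank_map_add_finrank_inf_ker (koszulDeg F n q) (koszulMul F n)]
  push_cast
  ring

/-- The contraction lowers the degree by two and so vanishes here; a closed element is then
determined by its top coefficient. -/
theorem koszulRank_of_lt_two [CharZero F] {q : ℕ} (hq : q < 2) :
    koszulRank F n q = hilbertCoeff n (n + 1) q - if n ≤ q then 1 else 0 := by
  have h1 := finrank_koszulDeg_inf_ker (F := F) (n := n) q
  have : Module.Finite F ↥(koszulDeg F n q ⊓ LinearMap.ker (koszulMul F n)) :=
    Submodule.finiteDimensional_inf_left _ _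
  have h2 := finrank_map_add_finrank_inf_ker
    (koszulDeg F n q ⊓ LinearMap.ker (koszulMul F n)) (koszulTop F n (q - n))
  have h3 : koszulDeg F n q ⊓ LinearMap.ker (koszulMul F n) ⊓
      LinearMap.ker (koszulTop F n (q - n)) = ⊥ := by
    rw [eq_bot_iff]
    rintro G ⟨⟨hG, hω⟩, hev⟩
    rw [Submodule.mem_bot, ← koszulMul_div hG hω hev, koszulContr_eq_zero hq hG]
    simp only [Pi.zero_apply, zero_div]
    exact map_zero (koszulMul F n)
  rw [h3, finrank_bot, finrank_map_koszulTop] at h2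
  rw [← h2] at h1
  push_cast at h1
  linarith

/-- A closed element of degree q + 2 is exact if and only if its top coefficient vanishes, so kernel
and image differ by at most the line of the top monomial. -/
theorem koszulRank_add_two [CharZero F] (q : ℕ) :
    koszulRank F n (q + 2) + koszulRank F n q =
      hilbertCoeff n (n + 1) (q + 2) - if n ≤ q + 2 then 1 else 0 := by
  have h1 := finrank_koszulDeg_inf_ker (F := F) (n := n) (q + 2)
  have : Module.Finite F ↥(koszulDeg F n (q + 2) ⊓ LinearMap.ker (koszulMul F n)) :=
    Submodule.finiteDimensional_inf_left _ _
  have h2 := finrank_map_add_finrank_inf_ker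
    (koszulDeg F n (q + 2) ⊓ LinearMap.ker (koszulMul F n)) (koszulTop F n (q + 2 - n))
  have h3 : koszulDeg F n (q + 2) ⊓ LinearMap.ker (koszulMul F n) ⊓
      LinearMap.ker (koszulTop F n (q + 2 - n)) = (koszulDeg F n q).map (koszulMul F n) := by
    apply le_antisymm
    · rintro G ⟨⟨hG, hω⟩, hev⟩
      refine ⟨_, fun S μ h => ?_, koszulMul_div hG hω hev⟩
      rw [koszulContr_mem hG S μ h, zero_div]
    · rintro _ ⟨G, hG, rfl⟩
      exact ⟨⟨koszulMul_mem hG, koszulMul_koszulMul G⟩, koszulMul_top G _⟩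
  rw [h3, finrank_map_koszulTop] at h2
  rw [← h2] at h1
  push_cast at h1
  unfold koszulRank at *
  linarith

end Koszul

/-! ### The coboundary on words of basis elements -/

section Words

open Finset

/-- Indices of the standard basis: `inl i` is `x_i`, `inr (some i)` is `y_i`, `inr none` is `z`. -/
abbrev Letter (n : ℕ) : Type := Fin n ⊕ Option (Fin n)

variable {F : Type*} [Field F] {n : ℕ}

/-- The parity of a basis element. -/
def letterParity : Letter n → ZMod 2 := Sum.elim (fun _ => 0) (fun _ => 1)

/-- The sign of swapping `a` behind `b`, if they are out of order. -/
def orderSign (F : Type*) [Field F] {n : ℕ} : Letter n → Letter n → F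
  | .inl i, .inl j => if j < i then -1 else 1
  | .inr _, .inl _ => -1
  | _, .inr _ => 1

/-- The product of the signs `orderSign a b` for `b ∈ s`. -/
def moveSign (F : Type*) [Field F] {n : ℕ} (a : Letter n) (s : Multiset (Letter n)) : F :=
  (s.map (orderSign F a)).prod

/-- The sign of sorting a word. -/
def wordSign (F : Type*) [Field F] {n : ℕ} : List (Letter n) → F
  | [] => 1
  | a :: l => moveSign F a l * wordSign F l

/-- The structure constants: `[a, b] = letterBracket a b • z`. -/
def letterBracket (F : Type*) [Field F] {n : ℕ} : Letter n → Letter n → F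
  | .inl i, .inr (some j) => if i = j then 1 else 0
  | .inr (some i), .inl j => if i = j then -1 else 0
  | _, _ => 0

theorem orderSign_mul_self (a b : Letter n) : orderSign F a b * orderSign F a b = 1 := by
  rcases a with i | i <;> rcases b with j | j <;> simp [orderSign]
  split_ifs <;> simp

theorem orderSign_mul_swap {a : Letter n} {i : Fin n} (h : a ≠ .inl i) :
    orderSign F a (.inl i) * orderSign F (.inl i) a = -1 := by
  rcases a with j | j
  · have h' : j ≠ i := fun e => h (by rw [e])
    rcases lt_or_gt_of_ne h' with h' | h' <;> simp [orderSign, h', h'.not_gt]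
  · simp [orderSign]

@[simp] theorem orderSign_inr (a : Letter n) (o : Option (Fin n)) :
    orderSign F a (.inr o) = 1 := by
  rcases a with j | j <;> rfl

theorem moveSign_cons (a b : Letter n) (s : Multiset (Letter n)) :
    moveSign F a (b ::ₘ s) = orderSign F a b * moveSign F a s := by
  simp [moveSign]

theorem moveSign_mul_self (a : Letter n) (s : Multiset (Letter n)) :
    moveSign F a s * moveSign F a s = 1 := by
  induction s using Multiset.induction_on with
  | empty => simp [moveSign]
  | cons b s ih =>
    rw [moveSign_cons, mul_mul_mul_comm, orderSign_mul_self, ih, one_mul]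

/-- An odd letter commutes with odd letters and anticommutes with even ones, so only the number of
even letters matters. -/
theorem moveSign_inr (o : Option (Fin n)) (s : Multiset (Letter n)) :
    moveSign F (.inr o) s = moveSign F (.inr none) s := by
  unfold moveSign
  congr 2
  ext b
  rcases b with b | b <;> rfl

theorem moveSign_erase {a b : Letter n} {s : Multiset (Letter n)} (hb : b ∈ s) :
    moveSign F a (s.erase b) = orderSign F a b * moveSign F a s := by
  conv_rhs => rw [← Multiset.cons_erase hb, moveSign_cons, ← mul_assoc, orderSign_mul_self, one_mul]

theorem wordSign_mul_self (l : List (Letter n)) : wordSign F l * wordSign F l = 1 := by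
  induction l with
  | nil => simp [wordSign]
  | cons a l ih =>
    rw [wordSign, mul_mul_mul_comm, moveSign_mul_self, ih, one_mul]

/-- `1` for odd numbers and `0` for even ones. -/
def oddIndicator (F : Type*) [Field F] (k : ℕ) : F := if Odd k then 1 else 0

theorem oddIndicator_zero : oddIndicator F 0 = 0 := by simp [oddIndicator]

theorem oddIndicator_succ (k : ℕ) : oddIndicator F (k + 1) = 1 - oddIndicator F k := by
  unfold oddIndicator
  by_cases h : Odd k
  · rw [if_pos h, if_neg (by simpa [Nat.even_add_one] using h)]; simp
  · rw [if_neg h, if_pos (Nat.not_odd_iff_even.1 h).add_one]; simp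

/-- The contribution of the brackets `[a, tₛ]` to the coboundary at the word `(a, t)`. -/
def bracketHead {q : ℕ} (a : Letter n) (h : (Fin q → Letter n) → F) (t : Fin (q + 1) → Letter n) :
    F :=
  ∑ s : Fin (q + 1), (-1) ^ ((s : ℕ) + (letterParity (t s) *
    ∑ u with u < s, letterParity (t u)).val) * (letterBracket F a (t s) * h (s.removeNth t))

/-- The coboundary operator on functions of words. -/
def wordCoboundary {q : ℕ} (f : (Fin q → Letter n) → F) (t : Fin (q + 1) → Letter n) : F :=
  ∑ s : Fin (q + 1), ∑ r : Fin q, if r.castSucc < s then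
    (-1) ^ ((s : ℕ) + (letterParity (t s) *
      ∑ u with r.castSucc < u ∧ u < s, letterParity (t u)).val) *
      (letterBracket F (t r.castSucc) (t s) *
        f (Function.update (s.removeNth t) r (.inr none))) else 0

theorem removeNth_succ_cons {α : Type*} {q : ℕ} (a : α) (t : Fin (q + 1) → α) (s : Fin (q + 1)) :
    s.succ.removeNth (Fin.cons a t : Fin (q + 2) → α) = Fin.cons a (s.removeNth t) := by
  ext i
  refine Fin.cases ?_ (fun i => ?_) i
  · simp [Fin.removeNth]
  · simp [Fin.removeNth]

/-- Pairs r < s with r = 0 put z in front; the remaining pairs give the coboundary of f(a, ·),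
negated since s is shifted by one. This is the recursion on the word length. -/
theorem wordCoboundary_cons {q : ℕ} (f : (Fin (q + 1) → Letter n) → F) (a : Letter n)
    (t : Fin (q + 1) → Letter n) :
    wordCoboundary f (Fin.cons a t) =
      -bracketHead a (fun u => f (Fin.cons (.inr none) u)) t -
        wordCoboundary (fun u => f (Fin.cons a u)) t := by
  unfold wordCoboundary bracketHead
  rw [Fin.sum_univ_succ]
  simp only [Fin.not_lt_zero, if_false, sum_const_zero, zero_add]
  rw [← sum_neg_distrib, ← sum_sub_distrib]
  refine sum_congr rfl fun s _ => ?_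
  rw [Fin.sum_univ_succ, removeNth_succ_cons, sub_eq_add_neg, ← sum_neg_distrib]
  congr 1
  · rw [if_pos (by simp)]
    have : (∑ u with (0 : Fin (q + 1)).castSucc < u ∧ u < s.succ,
        letterParity ((Fin.cons a t : Fin (q + 2) → Letter n) u)) =
        ∑ u with u < s, letterParity (t u) := by
      rw [sum_filter, sum_filter, Fin.sum_univ_succ]
      simp
    rw [this]
    simp only [Fin.cons_succ, Fin.castSucc_zero, Fin.cons_zero, Fin.val_succ, Fin.update_cons_zero]
    rw [add_right_comm, pow_succ]
    ring
  · refine sum_congr rfl fun r _ => ?_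
    rw [← Fin.succ_castSucc]
    simp only [Fin.succ_lt_succ_iff]
    have : (∑ u with r.castSucc.succ < u ∧ u < s.succ,
        letterParity ((Fin.cons a t : Fin (q + 2) → Letter n) u)) =
        ∑ u with r.castSucc < u ∧ u < s, letterParity (t u) := by
      rw [sum_filter, sum_filter, Fin.sum_univ_succ]
      simp
    rw [this]
    simp only [Fin.cons_succ, Fin.val_succ, ← Fin.cons_update]
    split_ifs
    · rw [add_right_comm, pow_succ]
      ring
    · simp

theorem neg_one_pow_val_add (a b : ZMod 2) :
    (-1 : F) ^ (a + b).val = (-1) ^ a.val * (-1) ^ b.val := by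
  rw [ZMod.val_add, ← neg_one_pow_eq_pow_mod_two, pow_add]

theorem letterParity_of_bracket {a b : Letter n} (h : letterBracket F a b ≠ 0) :
    letterParity b = 1 + letterParity a := by
  rcases a with i | _ | i <;> rcases b with j | _ | j <;> simp [letterBracket, letterParity] at *
  decide

/-- A nonzero bracket forces t_s to have parity 1 + |a|, so passing b costs the same sign for every
s. -/
theorem bracketHead_cons {q : ℕ} (h : (Fin (q + 1) → Letter n) → F) (a b : Letter n)
    (t : Fin (q + 1) → Letter n) :
    bracketHead a h (Fin.cons b t) = letterBracket F a b * h t -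
      (-1) ^ ((1 + letterParity a) * letterParity b).val *
        bracketHead a (fun u => h (Fin.cons b u)) t := by
  unfold bracketHead
  rw [Fin.sum_univ_succ, sub_eq_add_neg, ← neg_mul, mul_sum univ]
  congr 1
  · simp
  · refine sum_congr rfl fun s _ => ?_
    rw [removeNth_succ_cons]
    have : (∑ u with u < s.succ, letterParity ((Fin.cons b t : Fin (q + 2) → Letter n) u)) =
        letterParity b + ∑ u with u < s, letterParity (t u) := by
      rw [sum_filter, sum_filter, Fin.sum_univ_succ]
      simp
    rw [this]
    simp only [Fin.cons_succ, Fin.val_succ]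
    by_cases hb : letterBracket F a (t s) = 0
    · simp [hb]
    · rw [letterParity_of_bracket hb, mul_add, pow_add, neg_one_pow_val_add, pow_succ, pow_add]
      ring

/-- The multiset of letters of a word. -/
def wordContent {q : ℕ} (t : Fin q → Letter n) : Multiset (Letter n) := (List.ofFn t : List _)

/-- The sign of sorting a word. -/
def tupleSign (F : Type*) [Field F] {n q : ℕ} (t : Fin q → Letter n) : F :=
  wordSign F (List.ofFn t)

theorem wordContent_cons {q : ℕ} (a : Letter n) (t : Fin q → Letter n) :
    wordContent (Fin.cons a t : Fin (q + 1) → Letter n) = a ::ₘ wordContent t := by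
  simp [wordContent]

theorem tupleSign_cons {q : ℕ} (a : Letter n) (t : Fin q → Letter n) :
    tupleSign F (Fin.cons a t : Fin (q + 1) → Letter n) =
      moveSign F a (wordContent t) * tupleSign F t := by
  simp [tupleSign, wordContent, wordSign]

/-- The signed function on words of a function of the letter content. -/
def signedWord {q : ℕ} (H : Multiset (Letter n) → F) (t : Fin q → Letter n) : F :=
  tupleSign F t * H (wordContent t)

theorem signedWord_cons {q : ℕ} (H : Multiset (Letter n) → F) (a : Letter n) :
    (fun t : Fin q → Letter n => signedWord H (Fin.cons a t : Fin (q + 1) → Letter n)) =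
      signedWord fun s => moveSign F a s * H (a ::ₘ s) := by
  ext t
  simp only [signedWord, wordContent_cons, tupleSign_cons]
  ring

theorem bracketHead_none {q : ℕ} (h : (Fin q → Letter n) → F) (t : Fin (q + 1) → Letter n) :
    bracketHead (.inr none) h t = 0 := by
  refine sum_eq_zero fun s _ => ?_
  simp [letterBracket]

theorem wordContent_zero (t : Fin 0 → Letter n) : wordContent t = 0 := by
  simp [wordContent]

theorem tupleSign_zero (t : Fin 0 → Letter n) : tupleSign F t = 1 := by
  simp [tupleSign, wordSign]

theorem bracketHead_of_isEmpty (a b : Letter n) (h : (Fin 0 → Letter n) → F) (t : Fin 0 → Letter n) :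
    bracketHead a h (Fin.cons b t) = letterBracket F a b * h t := by
  simp [bracketHead]

/-- Odd letters commute, so all occurrences of y_j contribute equally and the multiplicity appears.
-/
theorem bracketHead_inl {q : ℕ} (j : Fin n) (H : Multiset (Letter n) → F)
    (t : Fin (q + 1) → Letter n) :
    bracketHead (.inl j) (signedWord H) t = tupleSign F t * (moveSign F (.inr none) (wordContent t) *
      ((wordContent t).count (.inr (some j)) *
        H ((wordContent t).erase (.inr (some j))))) := by
  induction q generalizing H with
  | zero =>
    induction t using Fin.consCases with
    | cons b t =>
      rw [bracketHead_of_isEmpty, wordContent_cons, tupleSign_cons, signedWord, wordContent_zero,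
        tupleSign_zero]
      rcases b with b | _ | b
      · simp [letterBracket]
      · simp [letterBracket]
      · rcases eq_or_ne j b with rfl | h
        · simp [letterBracket, moveSign]
        · simp [letterBracket, h]
  | succ q ih =>
    induction t using Fin.consCases with
    | cons b t =>
      rw [bracketHead_cons, signedWord_cons, ih, wordContent_cons, tupleSign_cons, signedWord,
        moveSign_cons]
      generalize wordContent t = s
      by_cases hb : b = .inr (some j)
      · subst hb
        rw [Multiset.count_cons_self, Multiset.erase_cons_head]
        have h1 : letterBracket F (.inl j) (.inr (some j)) = 1 := by simp [letterBracket]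
        rw [h1, moveSign_inr (some j) s, moveSign_inr]
        have h3 := moveSign_mul_self (F := F) (.inr none) s
        by_cases hm : .inr (some j) ∈ s
        · rw [Multiset.cons_erase hm, moveSign_erase hm, moveSign_inr (some j) s]
          simp [letterParity, ZMod.val_one]
          linear_combination (-(tupleSign F t * H s)) * h3
        · rw [Multiset.count_eq_zero_of_notMem hm]
          simp [letterParity, ZMod.val_one]
          linear_combination (-(tupleSign F t * H s)) * h3
      · have h1 : letterBracket F (.inl j) b = 0 := by
          rcases b with b | _ | b
          · rfl
          · rfl
          · have : j ≠ b := by rintro rfl; exact hb rfl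
            simp [letterBracket, this]
        have h2 : (-1 : F) ^ ((1 + letterParity (.inl j : Letter n)) * letterParity b).val =
            - orderSign F (.inr none) b := by
          rcases b with b | b <;> simp [letterParity, orderSign, ZMod.val_one]
        rw [h1, h2, Multiset.count_cons_of_ne (Ne.symm hb), Multiset.erase_cons_tail _ hb]
        by_cases hm : .inr (some j) ∈ s
        · rw [moveSign_erase hm, orderSign_inr]
          ring
        · simp [Multiset.count_eq_zero_of_notMem hm]

/-- Successive occurrences of x_j contribute with alternating signs, so only the parity of their
number survives. Here H need not vanish on repeated even letters. -/
theorem bracketHead_inr {q : ℕ} (j : Fin n) (H : Multiset (Letter n) → F)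
    (t : Fin (q + 1) → Letter n) :
    bracketHead (.inr (some j)) (signedWord H) t =
      -(tupleSign F t * (moveSign F (.inl j) (wordContent t) *
        (oddIndicator F ((wordContent t).count (.inl j)) * H ((wordContent t).erase (.inl j))))) := by
  have hself : orderSign F (.inl j) (.inl j) = 1 := by simp [orderSign]
  induction q generalizing H with
  | zero =>
    induction t using Fin.consCases with
    | cons b t =>
      rw [bracketHead_of_isEmpty, wordContent_cons, tupleSign_cons, signedWord, wordContent_zero,
        tupleSign_zero]
      rcases b with b | _ | b
      · rcases eq_or_ne j b with rfl | h
        · simp [letterBracket, moveSign, hself, oddIndicator]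
        · simp [letterBracket, h, oddIndicator]
      · simp [letterBracket, oddIndicator]
      · simp [letterBracket, oddIndicator]
  | succ q ih =>
    induction t using Fin.consCases with
    | cons b t =>
      rw [bracketHead_cons, signedWord_cons, ih, wordContent_cons, tupleSign_cons, signedWord,
        moveSign_cons]
      generalize wordContent t = s
      have h11 : (1 : ZMod 2) + 1 = 0 := by decide
      have h2 : (-1 : F) ^ ((1 + letterParity (.inr (some j) : Letter n)) * letterParity b).val =
          1 := by
        simp [letterParity, h11]
      rw [h2]
      by_cases hb : b = .inl j
      · subst hb
        have h1 : letterBracket F (.inr (some j)) (.inl j) = -1 := by simp [letterBracket]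
        have h3 := moveSign_mul_self (F := F) (.inl j) s
        rw [Multiset.count_cons_self, Multiset.erase_cons_head, h1, hself, oddIndicator_succ]
        by_cases hm : .inl j ∈ s
        · rw [Multiset.cons_erase hm, moveSign_erase hm, hself]
          linear_combination (tupleSign F t * H s) * h3
        · rw [Multiset.count_eq_zero_of_notMem hm, oddIndicator_zero]
          linear_combination (tupleSign F t * H s) * h3
      · have h1 : letterBracket F (.inr (some j)) b = 0 := by
          rcases b with b | _ | b
          · have : j ≠ b := by rintro rfl; exact hb rfl
            simp [letterBracket, this]
          · rfl
          · rfl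
        rw [h1, Multiset.count_cons_of_ne (Ne.symm hb), Multiset.erase_cons_tail _ hb]
        by_cases hm : .inl j ∈ s
        · rw [moveSign_erase hm]
          have h3 : orderSign F b (.inl j) * orderSign F (.inl j) b = -1 := orderSign_mul_swap hb
          have h4 := orderSign_mul_self (F := F) b (.inl j)
          have h5 : orderSign F b (.inl j) = - orderSign F (.inl j) b := by
            linear_combination orderSign F b (.inl j) * orderSign_mul_self (F := F) (.inl j) b * (-1)
              + orderSign F (.inl j) b * h3
          rw [h5]
          ring
        · rw [Multiset.count_eq_zero_of_notMem hm, oddIndicator_zero]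
          ring

/-- The `i`-th summand of the coboundary on functions of the letter content. -/
def contentTerm (H : Multiset (Letter n) → F) (s : Multiset (Letter n)) (i : Fin n) : F :=
  moveSign F (.inl i) s * (oddIndicator F (s.count (.inl i)) * (s.count (.inr (some i)) *
    H (.inr none ::ₘ (s.erase (.inl i)).erase (.inr (some i)))))

theorem contentTerm_eq_zero {H : Multiset (Letter n) → F} {s : Multiset (Letter n)} {i : Fin n}
    (h : .inl i ∉ s ∨ .inr (some i) ∉ s) : contentTerm H s i = 0 := by
  rcases h with h | h
  · simp [contentTerm, Multiset.count_eq_zero_of_notMem h, oddIndicator_zero]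
  · simp [contentTerm, Multiset.count_eq_zero_of_notMem h]

theorem moveSign_erase_erase {a : Letter n} {s : Multiset (Letter n)} {i : Fin n}
    (hx : .inl i ∈ s) (hy : .inr (some i) ∈ s) :
    moveSign F a (.inr none ::ₘ (s.erase (.inl i)).erase (.inr (some i))) =
      orderSign F a (.inl i) * moveSign F a s := by
  rw [moveSign_cons, moveSign_erase (by rwa [Multiset.mem_erase_of_ne (by simp)]),
    moveSign_erase hx]
  simp

theorem contentTerm_cons_of_ne (H : Multiset (Letter n) → F) (s : Multiset (Letter n)) {i : Fin n}
    {a : Letter n} (hx : a ≠ .inl i) (hy : a ≠ .inr (some i)) :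
    contentTerm (fun s => moveSign F a s * H (a ::ₘ s)) s i =
      -(moveSign F a s * contentTerm H (a ::ₘ s) i) := by
  by_cases h : .inl i ∈ s ∧ .inr (some i) ∈ s
  · simp only [contentTerm]
    rw [moveSign_erase_erase h.1 h.2, Multiset.count_cons_of_ne hx.symm,
      Multiset.count_cons_of_ne hy.symm, Multiset.erase_cons_tail _ hx,
      Multiset.erase_cons_tail _ hy, moveSign_cons _ a s, Multiset.cons_swap a]
    have h3 : orderSign F a (.inl i) * orderSign F (.inl i) a = -1 := orderSign_mul_swap hx
    have h5 : orderSign F a (.inl i) = - orderSign F (.inl i) a := by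
      linear_combination orderSign F a (.inl i) * orderSign_mul_self (F := F) (.inl i) a * (-1)
        + orderSign F (.inl i) a * h3
    rw [h5]
    ring
  · rw [not_and_or] at h
    rw [contentTerm_eq_zero h, contentTerm_eq_zero, mul_zero, neg_zero]
    simpa [hx.symm, hy.symm] using h

/-- The subtracted term matches the brackets of the new x_i with the y_i of the tail;
`contentTerm_cons_inr` is the counterpart for a new y_i. -/
theorem contentTerm_cons_inl (H : Multiset (Letter n) → F) (s : Multiset (Letter n)) (i : Fin n) :
    contentTerm (fun s => moveSign F (.inl i) s * H (.inl i ::ₘ s)) s i -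
      s.count (.inr (some i)) * H (.inr none ::ₘ s.erase (.inr (some i))) =
      -(moveSign F (.inl i) s * contentTerm H (.inl i ::ₘ s) i) := by
  have hself : orderSign F (.inl i) (.inl i) = 1 := by simp [orderSign]
  simp only [contentTerm]
  rw [Multiset.count_cons_self, Multiset.count_cons_of_ne (by simp), Multiset.erase_cons_head,
    moveSign_cons _ (.inl i) s, hself, oddIndicator_succ]
  have h3 := moveSign_mul_self (F := F) (.inl i) s
  by_cases hy : .inr (some i) ∈ s
  · by_cases hx : .inl i ∈ s
    · rw [moveSign_erase_erase hx hy, hself, Multiset.cons_swap,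
        ← Multiset.erase_cons_tail _ (by simp : (.inl i : Letter n) ≠ .inr (some i)),
        Multiset.cons_erase hx]
      linear_combination (s.count (.inr (some i)) *
        H (.inr none ::ₘ s.erase (.inr (some i)))) * h3
    · rw [Multiset.count_eq_zero_of_notMem hx, oddIndicator_zero]
      linear_combination (s.count (.inr (some i)) *
        H (.inr none ::ₘ s.erase (.inr (some i)))) * h3
  · rw [Multiset.count_eq_zero_of_notMem hy]
    simp

theorem contentTerm_cons_inr (H : Multiset (Letter n) → F) (s : Multiset (Letter n)) (i : Fin n) :
    contentTerm (fun s => moveSign F (.inr (some i)) s * H (.inr (some i) ::ₘ s)) s i -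
      moveSign F (.inr none) s * (moveSign F (.inl i) s * (oddIndicator F (s.count (.inl i)) *
        H (.inr none ::ₘ s.erase (.inl i)))) =
      -(moveSign F (.inr (some i)) s * contentTerm H (.inr (some i) ::ₘ s) i) := by
  simp only [contentTerm]
  rw [Multiset.count_cons_self, Multiset.count_cons_of_ne (by simp),
    Multiset.erase_cons_tail _ (by simp), Multiset.erase_cons_head,
    moveSign_cons _ (.inr (some i)) s, orderSign_inr,
    moveSign_inr (some i) s]
  by_cases hx : .inl i ∈ s
  · by_cases hy : .inr (some i) ∈ s
    · rw [moveSign_erase_erase hx hy, Multiset.cons_swap,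
        Multiset.cons_erase (by rwa [Multiset.mem_erase_of_ne (by simp)]), moveSign_inr (some i) s]
      simp [orderSign]
      ring
    · rw [Multiset.count_eq_zero_of_notMem hy]
      push_cast
      ring
  · rw [Multiset.count_eq_zero_of_notMem hx, oddIndicator_zero]
    ring

/-- The coboundary of a signed function of the letter content. -/
theorem wordCoboundary_signedWord {q : ℕ} (H : Multiset (Letter n) → F)
    (t : Fin (q + 1) → Letter n) :
    wordCoboundary (signedWord H) t =
      -(tupleSign F t * ∑ i, contentTerm H (wordContent t) i) := by
  -- Fixing the first letter turns a signed function into the signed function of another H, hence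
  -- the generalization.
  induction q generalizing H with
  | zero =>
    -- A one-letter word has no pair r < s, and its content cannot contain both x_i and y_i.
    have h1 : wordCoboundary (signedWord H) t = 0 := by
      simp [wordCoboundary]
    rw [h1, sum_eq_zero, mul_zero, neg_zero]
    intro i _
    apply contentTerm_eq_zero
    simp only [wordContent, List.ofFn_succ, List.ofFn_zero, Multiset.coe_singleton,
      Multiset.mem_singleton]
    by_contra! h
    exact absurd (h.1.trans h.2.symm) (by simp)
  | succ q ih =>
    induction t using Fin.consCases with
    | cons a t =>
      rw [wordCoboundary_cons, signedWord_cons, signedWord_cons, ih, wordContent_cons,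
        tupleSign_cons]
      rcases a with j | _ | j
      · rw [bracketHead_inl]
        generalize wordContent t = s
        have key : ∀ i, contentTerm (fun s => moveSign F (.inl j) s * H (.inl j ::ₘ s)) s i -
            (if i = j then s.count (.inr (some j)) * H (.inr none ::ₘ s.erase (.inr (some j))) else 0)
            = -(moveSign F (.inl j) s * contentTerm H (.inl j ::ₘ s) i) := by
          intro i
          split_ifs with h
          · subst h
            exact contentTerm_cons_inl H s i
          · rw [sub_zero]
            exact contentTerm_cons_of_ne H s (by simpa using Ne.symm h) (by simp)
        have hs := sum_congr rfl fun i (_ : i ∈ univ) => key i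
        rw [sum_sub_distrib, sum_ite_eq' univ j, if_pos (mem_univ j), sum_neg_distrib,
          ← mul_sum] at hs
        have h1 : moveSign F (.inr none) s * (s.count (.inr (some j)) *
            (moveSign F (.inr none) (s.erase (.inr (some j))) *
              H (.inr none ::ₘ s.erase (.inr (some j))))) =
            s.count (.inr (some j)) * H (.inr none ::ₘ s.erase (.inr (some j))) := by
          by_cases hm : .inr (some j) ∈ s
          · rw [moveSign_erase hm, orderSign_inr]
            linear_combination (s.count (.inr (some j)) *
              H (.inr none ::ₘ s.erase (.inr (some j)))) *
                moveSign_mul_self (F := F) (.inr none) s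
          · simp [Multiset.count_eq_zero_of_notMem hm]
        rw [h1]
        linear_combination tupleSign F t * hs
      · rw [bracketHead_none]
        generalize wordContent t = s
        have hs := sum_congr rfl fun i (_ : i ∈ univ) => contentTerm_cons_of_ne H s
          (i := i) (a := .inr none) (by simp) (by simp)
        rw [sum_neg_distrib, ← mul_sum] at hs
        rw [hs]
        ring
      · rw [bracketHead_inr]
        generalize wordContent t = s
        have key : ∀ i, contentTerm
            (fun s => moveSign F (.inr (some j)) s * H (.inr (some j) ::ₘ s)) s i -
            (if i = j then moveSign F (.inr none) s * (moveSign F (.inl j) s *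
              (oddIndicator F (s.count (.inl j)) * H (.inr none ::ₘ s.erase (.inl j)))) else 0)
            = -(moveSign F (.inr (some j)) s * contentTerm H (.inr (some j) ::ₘ s) i) := by
          intro i
          split_ifs with h
          · subst h
            exact contentTerm_cons_inr H s i
          · rw [sub_zero]
            exact contentTerm_cons_of_ne H s (by simp) (by simpa using Ne.symm h)
        have hs := sum_congr rfl fun i (_ : i ∈ univ) => key i
        rw [sum_sub_distrib, sum_ite_eq' univ j, if_pos (mem_univ j), sum_neg_distrib,
          ← mul_sum] at hs
        have h1 : oddIndicator F (s.count (.inl j)) * (moveSign F (.inr none) (s.erase (.inl j)) *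
              H (.inr none ::ₘ s.erase (.inl j))) =
            -(moveSign F (.inr none) s * (oddIndicator F (s.count (.inl j)) *
              H (.inr none ::ₘ s.erase (.inl j)))) := by
          by_cases hm : .inl j ∈ s
          · rw [moveSign_erase hm]
            simp [orderSign]
            ring
          · simp [Multiset.count_eq_zero_of_notMem hm, oddIndicator_zero]
        rw [h1]
        linear_combination tupleSign F t * hs

end Words

/-! ### Super-alternating functions as elements of the Koszul space -/

section Content

open Finset

variable {F : Type*} [Field F] {n : ℕ}

theorem wordContent_eq_map {q : ℕ} (t : Fin q → Letter n) :
    wordContent t = (univ : Finset (Fin q)).val.map t := by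
  rw [wordContent, Fin.univ_val_map]

theorem card_wordContent {q : ℕ} (t : Fin q → Letter n) : Multiset.card (wordContent t) = q := by
  simp [wordContent]

theorem wordContent_comp {q : ℕ} (t : Fin q → Letter n) (σ : Equiv.Perm (Fin q)) :
    wordContent (t ∘ σ) = wordContent t :=
  Multiset.coe_eq_coe.2 (σ.ofFn_comp_perm t)

theorem exists_wordContent_eq {q : ℕ} {s : Multiset (Letter n)} (hs : Multiset.card s = q) :
    ∃ t : Fin q → Letter n, wordContent t = s := by
  induction s using Quot.inductionOn with
  | _ l =>
    have hl : l.length = q := hs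
    subst hl
    exact ⟨l.get, by simp [wordContent]⟩

theorem exists_perm_of_wordContent_eq {q : ℕ} {t t' : Fin q → Letter n}
    (h : wordContent t = wordContent t') : ∃ σ : Equiv.Perm (Fin q), t = t' ∘ σ := by
  have hc : ∀ b, Nonempty ({i // t i = b} ≃ {i // t' i = b}) := by
    intro b
    rw [← Fintype.card_eq, Fintype.card_subtype, Fintype.card_subtype]
    have := congrArg (Multiset.count b) h
    rw [wordContent_eq_map, wordContent_eq_map, Multiset.count_map, Multiset.count_map] at this
    have e : ∀ u : Fin q → Letter n, #{x | u x = b} =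
        Multiset.card (Multiset.filter (fun a => b = u a) univ.val) := fun u => by
      rw [Finset.card_def, Finset.filter_val]
      exact congrArg _ (Multiset.filter_congr fun _ _ => eq_comm)
    rw [e, e, this]
  refine ⟨Equiv.ofFiberEquiv fun b => (hc b).some, ?_⟩
  ext i : 1
  exact (Equiv.ofFiberEquiv_map (fun b => (hc b).some) i).symm

/-- An adjacent swap affects only the relative order of the two letters swapped. -/
theorem tupleSign_swap {q : ℕ} (t : Fin q → Letter n) {i j : Fin q} (hij : (i : ℕ) + 1 = j) :
    tupleSign F (t ∘ Equiv.swap i j) * orderSign F (t i) (t j) =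
      tupleSign F t * orderSign F (t j) (t i) := by
  induction q with
  | zero => exact i.elim0
  | succ q ih =>
    induction t using Fin.consCases with
    | cons a t =>
      obtain ⟨j, rfl⟩ := Fin.exists_succ_eq.2 (show j ≠ 0 by rintro rfl; simp at hij)
      refine Fin.cases (fun hij => ?_) (fun i hij => ?_) i hij
      · obtain _ | q := q
        · exact j.elim0
        have hj : j = 0 := by
          ext
          simpa using hij.symm
        subst hj
        induction t using Fin.consCases with
        | cons b t =>
          have h1 : (Fin.cons a (Fin.cons b t : Fin (q + 1) → Letter n) : Fin (q + 2) → Letter n) ∘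
              Equiv.swap 0 (Fin.succ 0) = Fin.cons b (Fin.cons a t : Fin (q + 1) → Letter n) := by
            ext k : 1
            refine Fin.cases ?_ (fun k => Fin.cases ?_ (fun k => ?_) k) k
            · simp
            · simp
            · rw [Function.comp_apply, Equiv.swap_apply_of_ne_of_ne (Fin.succ_ne_zero _)
                (fun h => Fin.succ_ne_zero k (Fin.succ_injective _ h))]
              simp
          rw [h1]
          simp only [tupleSign_cons, wordContent_cons, moveSign_cons, Fin.cons_zero, Fin.cons_succ]
          ring
      · have h1 : (Fin.cons a t : Fin (q + 1) → Letter n) ∘ Equiv.swap i.succ j.succ =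
            Fin.cons a (t ∘ Equiv.swap i j) := by
          ext k : 1
          refine Fin.cases ?_ (fun k => ?_) k
          · rw [Function.comp_apply, Equiv.swap_apply_of_ne_of_ne (Fin.succ_ne_zero _).symm
              (Fin.succ_ne_zero _).symm]
            simp
          · simp only [Function.comp_apply, Fin.cons_succ]
            have : Equiv.swap i.succ j.succ k.succ = (Equiv.swap i j k).succ :=
              ((Fin.succ_injective q).map_swap i j k).symm
            rw [this, Fin.cons_succ]
        rw [h1]
        simp only [tupleSign_cons, wordContent_comp, Fin.cons_succ]
        have := ih t (i := i) (j := j) (by simpa using hij)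
        rw [mul_assoc, this, mul_assoc]

/-- Two equal even letters are excluded: their order sign is 1, while the super-exterior rule
demands a change of sign. -/
theorem orderSign_swap {a b : Letter n} (h : a ≠ b ∨ ∃ o, a = .inr o) :
    orderSign F b a =
      -((-1) ^ (letterParity a * letterParity b).val * orderSign F a b) := by
  rcases a with i | i <;> rcases b with j | j
  · have h' : i ≠ j := by simpa using h
    rcases lt_or_gt_of_ne h' with h' | h' <;> simp [orderSign, letterParity, h', h'.not_gt]
  · simp [orderSign, letterParity]
  · simp [orderSign, letterParity]
  · simp [orderSign, letterParity, ZMod.val_one]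

/-- The even letters of a multiset. -/
def evenPart (s : Multiset (Letter n)) : Multiset (Fin n) := s.filterMap Sum.getLeft?

/-- The odd letters of a multiset. -/
def oddPart (s : Multiset (Letter n)) : Multiset (Option (Fin n)) := s.filterMap Sum.getRight?

@[simp] theorem evenPart_cons_inl (i : Fin n) (s : Multiset (Letter n)) :
    evenPart (.inl i ::ₘ s) = i ::ₘ evenPart s := Multiset.filterMap_cons_some _ _ _ rfl

@[simp] theorem evenPart_cons_inr (o : Option (Fin n)) (s : Multiset (Letter n)) :
    evenPart (.inr o ::ₘ s) = evenPart s := Multiset.filterMap_cons_none _ _ rfl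

@[simp] theorem oddPart_cons_inl (i : Fin n) (s : Multiset (Letter n)) :
    oddPart (.inl i ::ₘ s) = oddPart s := Multiset.filterMap_cons_none _ _ rfl

@[simp] theorem oddPart_cons_inr (o : Option (Fin n)) (s : Multiset (Letter n)) :
    oddPart (.inr o ::ₘ s) = o ::ₘ oddPart s := Multiset.filterMap_cons_some _ _ _ rfl

@[simp] theorem evenPart_zero : evenPart (0 : Multiset (Letter n)) = 0 := rfl

@[simp] theorem oddPart_zero : oddPart (0 : Multiset (Letter n)) = 0 := rfl

theorem map_evenPart_add_map_oddPart (s : Multiset (Letter n)) :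
    (evenPart s).map Sum.inl + (oddPart s).map Sum.inr = s := by
  induction s using Multiset.induction_on with
  | empty => simp
  | cons a s ih =>
    rcases a with i | o
    · simp [ih]
    · simp [ih]

theorem card_evenPart_add_card_oddPart (s : Multiset (Letter n)) :
    Multiset.card (evenPart s) + Multiset.card (oddPart s) = Multiset.card s := by
  conv_rhs => rw [← map_evenPart_add_map_oddPart s]
  simp

theorem evenPart_map_add_map (s : Multiset (Fin n)) (μ : Multiset (Option (Fin n))) :
    evenPart (s.map Sum.inl + μ.map Sum.inr) = s := by
  induction s using Multiset.induction_on with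
  | empty =>
    induction μ using Multiset.induction_on with
    | empty => simp
    | cons o μ ih => simpa using ih
  | cons i s ih => simpa using ih

theorem oddPart_map_add_map (s : Multiset (Fin n)) (μ : Multiset (Option (Fin n))) :
    oddPart (s.map Sum.inl + μ.map Sum.inr) = μ := by
  induction s using Multiset.induction_on with
  | empty =>
    induction μ using Multiset.induction_on with
    | empty => simp
    | cons o μ ih => simpa using ih
  | cons i s ih => simpa using ih

theorem count_evenPart (s : Multiset (Letter n)) (i : Fin n) :
    (evenPart s).count i = s.count (.inl i) := by
  induction s using Multiset.induction_on with
  | empty => simp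
  | cons a s ih => rcases a with j | o <;> simp [Multiset.count_cons, ih]

theorem count_oddPart (s : Multiset (Letter n)) (o : Option (Fin n)) :
    (oddPart s).count o = s.count (.inr o) := by
  induction s using Multiset.induction_on with
  | empty => simp
  | cons a s ih => rcases a with j | o <;> simp [Multiset.count_cons, ih]

theorem evenPart_erase_inl (s : Multiset (Letter n)) (i : Fin n) :
    evenPart (s.erase (.inl i)) = (evenPart s).erase i := by
  ext j
  rcases eq_or_ne j i with rfl | h
  · rw [Multiset.count_erase_self, count_evenPart, count_evenPart, Multiset.count_erase_self]
  · rw [Multiset.count_erase_of_ne h, count_evenPart, count_evenPart,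
      Multiset.count_erase_of_ne (by simpa using h)]

theorem evenPart_erase_inr (s : Multiset (Letter n)) (o : Option (Fin n)) :
    evenPart (s.erase (.inr o)) = evenPart s := by
  ext j
  rw [count_evenPart, count_evenPart, Multiset.count_erase_of_ne (by simp)]

theorem oddPart_erase_inl (s : Multiset (Letter n)) (i : Fin n) :
    oddPart (s.erase (.inl i)) = oddPart s := by
  ext j
  rw [count_oddPart, count_oddPart, Multiset.count_erase_of_ne (by simp)]

theorem oddPart_erase_inr (s : Multiset (Letter n)) (o : Option (Fin n)) :
    oddPart (s.erase (.inr o)) = (oddPart s).erase o := by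
  ext j
  rcases eq_or_ne j o with rfl | h
  · rw [Multiset.count_erase_self, count_oddPart, count_oddPart, Multiset.count_erase_self]
  · rw [Multiset.count_erase_of_ne h, count_oddPart, count_oddPart,
      Multiset.count_erase_of_ne (by simpa using h)]

open Classical in
/-- The function of the letter content given by an element of the Koszul space. -/
def contentFun (G : KoszulSpace F n) (s : Multiset (Letter n)) : F :=
  if (evenPart s).Nodup then G (evenPart s).toFinset (oddPart s) else 0

theorem contentFun_map_add_map (G : KoszulSpace F n) (S : Finset (Fin n))
    (μ : Multiset (Option (Fin n))) : contentFun G (S.val.map Sum.inl + μ.map Sum.inr) = G S μ := by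
  unfold contentFun
  rw [evenPart_map_add_map, oddPart_map_add_map, if_pos S.nodup, Finset.val_toFinset]

theorem moveSign_inl_eq_wedgeSign {s : Multiset (Letter n)} (hs : (evenPart s).Nodup) (i : Fin n) :
    moveSign F (.inl i) s = wedgeSign F (evenPart s).toFinset i := by
  induction s using Multiset.induction_on with
  | empty => simp [moveSign, wedgeSign]
  | cons a s ih =>
    rw [moveSign_cons]
    rcases a with j | o
    · rw [evenPart_cons_inl, Multiset.nodup_cons] at hs
      rw [evenPart_cons_inl, Multiset.toFinset_cons, wedgeSign_insert (by simpa using hs.1),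
        ih hs.2]
      rfl
    · rw [evenPart_cons_inr] at hs
      rw [orderSign_inr, one_mul, evenPart_cons_inr, ih hs]

/-- The coboundary on functions of the content is the Koszul operator composed with the shift. -/
theorem sum_contentTerm (G : KoszulSpace F n) (s : Multiset (Letter n)) :
    ∑ i, contentTerm (contentFun G) s i =
      contentFun (koszulMul F n (koszulShift F n G)) s := by
  have hev : ∀ i, evenPart (.inr none ::ₘ (s.erase (.inl i)).erase (.inr (some i))) =
      (evenPart s).erase i := fun i => by
    rw [evenPart_cons_inr, evenPart_erase_inr, evenPart_erase_inl]
  have hodd : ∀ i, oddPart (.inr none ::ₘ (s.erase (.inl i)).erase (.inr (some i))) =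
      none ::ₘ (oddPart s).erase (some i) := fun i => by
    rw [oddPart_cons_inr, oddPart_erase_inr, oddPart_erase_inl]
  unfold contentTerm contentFun
  simp only [hev, hodd, ← count_evenPart, ← count_oddPart]
  split_ifs with hs
  · rw [koszulMul_apply, ← sum_subset (subset_univ (evenPart s).toFinset)]
    · refine sum_congr rfl fun i hi => ?_
      have hi' : i ∈ evenPart s := by simpa using hi
      have h1 : ((evenPart s).erase i).toFinset = (evenPart s).toFinset.erase i := by
        ext j
        rw [Multiset.mem_toFinset, hs.mem_erase_iff, mem_erase, Multiset.mem_toFinset]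
      rw [if_pos (hs.erase i), moveSign_inl_eq_wedgeSign hs, h1,
        Multiset.count_eq_one_of_mem hs hi']
      simp [oddIndicator, koszulShift]
    · intro i _ hi
      have hi' : i ∉ evenPart s := by simpa using hi
      simp [Multiset.count_eq_zero_of_notMem hi', oddIndicator_zero]
  · refine sum_eq_zero fun i _ => ?_
    split_ifs with h
    · have h2 : (evenPart s).count i = 2 := by
        rw [Multiset.nodup_iff_count_le_one] at h hs
        push Not at hs
        obtain ⟨j, hj⟩ := hs
        have hji : j = i := by
          by_contra hji
          have := h j
          rw [Multiset.count_erase_of_ne hji] at this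
          omega
        subst hji
        have := h j
        rw [Multiset.count_erase_self] at this
        omega
      rw [h2]
      simp [oddIndicator, Nat.odd_iff]
    · simp

/-- Functions of words that change by the super-exterior sign under adjacent swaps. -/
def IsSuperAlternating {q : ℕ} (f : (Fin q → Letter n) → F) : Prop :=
  ∀ (t : Fin q → Letter n) (i j : Fin q), (i : ℕ) + 1 = j →
    f (t ∘ Equiv.swap i j) = -((-1) ^ (letterParity (t i) * letterParity (t j)).val * f t)

theorem isSuperAlternating_signedWord {q : ℕ} (G : KoszulSpace F n) :
    IsSuperAlternating (q := q) (signedWord (contentFun G)) := by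
  intro t i j hij
  unfold signedWord
  rw [wordContent_comp]
  by_cases h : t i ≠ t j ∨ ∃ o, t i = .inr o
  · have h1 := tupleSign_swap (F := F) t hij
    have h2 := orderSign_swap (F := F) h
    have h3 := orderSign_mul_self (F := F) (t i) (t j)
    rw [h2] at h1
    linear_combination (orderSign F (t i) (t j) * contentFun G (wordContent t)) * h1 -
      contentFun G (wordContent t) * (tupleSign F (t ∘ Equiv.swap i j) +
        tupleSign F t * (-1) ^ (letterParity (t i) * letterParity (t j)).val) * h3
  -- For two equal even letters both sides vanish, because `contentFun` is zero on repeated even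
  -- letters.
  · push Not at h
    obtain ⟨h1, h2⟩ := h
    obtain ⟨k, hk⟩ : ∃ k, t i = .inl k := by
      rcases hti : t i with k | o
      · exact ⟨k, rfl⟩
      · exact absurd hti (h2 o)
    have hne : i ≠ j := by
      rintro rfl
      omega
    have h0 : contentFun G (wordContent t) = 0 := by
      unfold contentFun
      refine if_neg fun hnd => ?_
      have := Multiset.nodup_iff_count_le_one.1 hnd k
      rw [count_evenPart, wordContent_eq_map, Multiset.count_map] at this
      have h3 : 2 ≤ #{a : Fin q | Sum.inl k = t a} := by
        rw [← card_pair hne]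
        refine card_le_card ?_
        intro a ha
        rcases mem_insert.1 ha with rfl | ha
        · simp [hk]
        · rw [mem_singleton.1 ha]
          simp [← h1, hk]
      have h4 : #{a : Fin q | Sum.inl k = t a} ≤ 1 := this
      omega
    rw [h0]
    simp

/-- Adjacent transpositions generate the symmetric group, and under each of them the two signs
cancel, or the word does not change at all. -/
theorem IsSuperAlternating.tupleSign_mul_comp [CharZero F] {q : ℕ} {f : (Fin q → Letter n) → F}
    (hf : IsSuperAlternating f) (σ : Equiv.Perm (Fin q)) (t : Fin q → Letter n) :
    tupleSign F (t ∘ σ) * f (t ∘ σ) = tupleSign F t * f t := by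
  obtain _ | q := q
  · rw [Subsingleton.elim σ 1]
    rfl
  have hσ : σ ∈ Submonoid.closure
      (Set.range fun i : Fin q => Equiv.swap i.castSucc i.succ) := by
    rw [Equiv.Perm.mclosure_swap_castSucc_succ]
    trivial
  induction hσ using Submonoid.closure_induction generalizing t with
  | mem σ h =>
    obtain ⟨i, rfl⟩ := h
    have hi : (i.castSucc : ℕ) + 1 = i.succ := by simp
    dsimp only
    by_cases h : t i.castSucc ≠ t i.succ ∨ ∃ o, t i.castSucc = .inr o
    · have h1 := tupleSign_swap (F := F) t hi
      have h2 := orderSign_swap (F := F) h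
      have h3 := orderSign_mul_self (F := F) (t i.castSucc) (t i.succ)
      have h4 := hf t _ _ hi
      have h5 : ((-1 : F) ^ (letterParity (t i.castSucc) * letterParity (t i.succ)).val) *
          ((-1 : F) ^ (letterParity (t i.castSucc) * letterParity (t i.succ)).val) = 1 := by
        rw [← mul_pow]
        simp
      rw [h2] at h1
      rw [h4]
      generalize (-1 : F) ^ (letterParity (t i.castSucc) * letterParity (t i.succ)).val = e at *
      generalize orderSign F (t i.castSucc) (t i.succ) = o at *
      linear_combination (-o * e * f t) * h1 + (tupleSign F (t ∘ Equiv.swap i.castSucc i.succ) *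
        e * f t + tupleSign F t * f t * e * e) * h3 + tupleSign F t * f t * h5
    · push Not at h
      have : t ∘ Equiv.swap i.castSucc i.succ = t := by
        ext k : 1
        rw [Function.comp_apply, Equiv.swap_apply_def]
        split_ifs with h1 h2
        · rw [h1, h.1]
        · rw [h2, h.1]
        · rfl
      rw [this]
  | one => rfl
  | mul σ τ _ _ hσ hτ =>
    rw [Equiv.Perm.coe_mul, ← Function.comp_assoc, hτ, hσ]

theorem IsSuperAlternating.tupleSign_mul_eq [CharZero F] {q : ℕ} {f : (Fin q → Letter n) → F}
    (hf : IsSuperAlternating f) {t t' : Fin q → Letter n} (h : wordContent t = wordContent t') :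
    tupleSign F t * f t = tupleSign F t' * f t' := by
  obtain ⟨σ, rfl⟩ := exists_perm_of_wordContent_eq h
  exact hf.tupleSign_mul_comp σ t'

theorem tupleSign_mul_self {q : ℕ} (t : Fin q → Letter n) : tupleSign F t * tupleSign F t = 1 :=
  wordSign_mul_self _

/-- Up to sign the repeated even letter can be moved to the first two places; swapping these gives f
= -f. -/
theorem IsSuperAlternating.eq_zero [CharZero F] {q : ℕ} {f : (Fin q → Letter n) → F}
    (hf : IsSuperAlternating f) {t : Fin q → Letter n} (h : ¬(evenPart (wordContent t)).Nodup) :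
    f t = 0 := by
  rw [Multiset.nodup_iff_count_le_one] at h
  push Not at h
  obtain ⟨k, hk⟩ := h
  rw [count_evenPart] at hk
  obtain ⟨s, hs⟩ := Multiset.exists_cons_of_mem
    (Multiset.count_pos.1 (by omega : 0 < (wordContent t).count (.inl k)))
  rw [hs, Multiset.count_cons_self] at hk
  obtain ⟨s, rfl⟩ := Multiset.exists_cons_of_mem
    (Multiset.count_pos.1 (by omega : 0 < s.count (.inl k)))
  have hq := card_wordContent t
  rw [hs, Multiset.card_cons, Multiset.card_cons] at hq
  subst hq
  obtain ⟨u, hu⟩ := exists_wordContent_eq (s := s) rfl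
  set t' : Fin (Multiset.card s + 1 + 1) → Letter n :=
    Fin.cons (.inl k) (Fin.cons (.inl k) u : Fin (_ + 1) → Letter n) with ht'
  have h1 : wordContent t = wordContent t' := by
    rw [hs, ht', wordContent_cons, wordContent_cons, hu]
  have h2 : f t' = 0 := by
    have h3 := hf t' 0 1 (by simp)
    have h4 : t' ∘ Equiv.swap 0 1 = t' := by
      ext k : 1
      rw [Function.comp_apply, Equiv.swap_apply_def]
      split_ifs with h1 h2
      · rw [h1]; rfl
      · rw [h2]; rfl
      · rfl
    rw [h4] at h3
    have h5 : letterParity (t' 0) = 0 := rfl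
    rw [h5, zero_mul, ZMod.val_zero, pow_zero, one_mul] at h3
    exact self_eq_neg.1 h3
  have h3 := hf.tupleSign_mul_eq h1
  rw [h2, mul_zero] at h3
  have h4 := tupleSign_mul_self (F := F) t
  linear_combination tupleSign F t * h3 - f t * h4

/-- The coefficient at a monomial is the signed value of f on any word with that content; the choice
does not matter by permutation invariance. -/
theorem IsSuperAlternating.exists_eq_signedWord [CharZero F] {q : ℕ}
    {f : (Fin q → Letter n) → F} (hf : IsSuperAlternating f) :
    ∃ G ∈ koszulDeg F n q, f = signedWord (contentFun G) := by
  have hex : ∀ S : Finset (Fin n), ∀ μ : Multiset (Option (Fin n)),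
      S.card + Multiset.card μ = q →
      ∃ t : Fin q → Letter n, wordContent t = S.val.map Sum.inl + μ.map Sum.inr :=
    fun S μ h => exists_wordContent_eq (by simpa using h)
  choose T hT using hex
  refine ⟨fun S μ => if h : S.card + Multiset.card μ = q then
    tupleSign F (T S μ h) * f (T S μ h) else 0, fun S μ h => dif_neg h, ?_⟩
  ext t
  unfold signedWord contentFun
  split_ifs with hnd
  · have hval : (evenPart (wordContent t)).toFinset.val = evenPart (wordContent t) := by
      rw [Multiset.toFinset_val, hnd.dedup]
    have hd : (evenPart (wordContent t)).toFinset.card + Multiset.card (oddPart (wordContent t)) =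
        q := by
      rw [Finset.card_def, hval, card_evenPart_add_card_oddPart, card_wordContent]
    beta_reduce
    rw [dif_pos hd, hf.tupleSign_mul_eq (t' := t)
      (by rw [hT, hval, map_evenPart_add_map_oddPart]), ← mul_assoc, tupleSign_mul_self, one_mul]
  · rw [mul_zero, hf.eq_zero hnd]

theorem eq_zero_of_signedWord_eq_zero {q : ℕ} {G : KoszulSpace F n} (hG : G ∈ koszulDeg F n q)
    (h : ∀ t : Fin q → Letter n, signedWord (contentFun G) t = 0) : G = 0 := by
  ext S μ
  by_cases hd : S.card + Multiset.card μ = q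
  · obtain ⟨t, ht⟩ := exists_wordContent_eq (q := q) (s := S.val.map Sum.inl + μ.map Sum.inr)
      (by simpa using hd)
    have h1 := h t
    rw [signedWord, ht, contentFun_map_add_map] at h1
    have h4 := tupleSign_mul_self (F := F) t
    change G S μ = 0
    linear_combination tupleSign F t * h1 - G S μ * h4
  · exact hG S μ hd

end Content

/-! ### The cochain complex of the Heisenberg superalgebra -/

section Heisenberg

open Finset

variable {F : Type*} [Field F] {n : ℕ}

/-- The standard basis of the Heisenberg superalgebra. -/
def heisenbergBasis (F : Type*) [Field F] (n : ℕ) :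
    Module.Basis (Letter n) F ((Fin n → F) × ((Fin n → F) × F)) :=
  ((Pi.basisFun F (Fin n)).prod ((Pi.basisFun F (Fin n)).prod
    (Module.Basis.singleton PUnit.{1} F))).reindex
      (Equiv.sumCongr (Equiv.refl _) (Equiv.optionEquivSumPUnit.{0} (Fin n)).symm)

theorem heisenbergBasis_inl (i : Fin n) :
    heisenbergBasis F n (.inl i) = (Pi.single i 1, 0, 0) := by
  simp [heisenbergBasis]
  rfl

theorem heisenbergBasis_some (i : Fin n) :
    heisenbergBasis F n (.inr (some i)) = (0, Pi.single i 1, 0) := by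
  simp [heisenbergBasis]

theorem heisenbergBasis_none : heisenbergBasis F n (.inr none) = (0, 0, 1) := by
  simp [heisenbergBasis]

theorem heisenbergBasis_mem_grade (b : Letter n) :
    heisenbergBasis F n b ∈ (heisenbergOdd F n).grade (letterParity b) := by
  rcases b with i | _ | i
  · simp [heisenbergBasis_inl, heisenbergOdd, letterParity]
  · simp [heisenbergBasis_none, heisenbergOdd, letterParity]
  · simp [heisenbergBasis_some, heisenbergOdd, letterParity]

theorem heisenbergBasis_repr_eq_zero {p : ZMod 2} {a : (Fin n → F) × ((Fin n → F) × F)}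
    (ha : a ∈ (heisenbergOdd F n).grade p) {b : Letter n} (hb : letterParity b ≠ p) :
    (heisenbergBasis F n).repr a b = 0 := by
  obtain rfl | rfl : p = 0 ∨ p = 1 := by
    clear ha hb
    revert p
    decide
  · have h : a.2 = 0 := by simpa [heisenbergOdd] using ha
    rcases b with i | _ | i
    · exact absurd rfl hb
    · simp [heisenbergBasis, h]
    · simp [heisenbergBasis, h]
  · have h : a.1 = 0 := by simpa [heisenbergOdd] using ha
    rcases b with i | o
    · simp [heisenbergBasis, h]
    · exact absurd rfl hb

theorem heisenbergOdd_bracket_apply (a b : (Fin n → F) × ((Fin n → F) × F)) :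
    (heisenbergOdd F n).bracket a b = (0, 0, ∑ i, (a.1 i * b.2.1 i - a.2.1 i * b.1 i)) := rfl

theorem heisenbergOdd_bracket_basis (a b : Letter n) :
    (heisenbergOdd F n).bracket (heisenbergBasis F n a) (heisenbergBasis F n b) =
      letterBracket F a b • heisenbergBasis F n (.inr none) := by
  rw [heisenbergOdd_bracket_apply]
  rcases a with i | _ | i <;> rcases b with j | _ | j <;>
    simp [heisenbergBasis_inl, heisenbergBasis_some, heisenbergBasis_none, letterBracket,
      Pi.single_apply, eq_comm]
  all_goals first | rfl | (split_ifs <;> simp [Prod.ext_iff])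

/-- The multilinear form with prescribed values on words of basis elements. -/
def wordForm (F : Type*) [Field F] (n q : ℕ) : ((Fin q → Letter n) → F) →ₗ[F]
    MultilinearMap F (fun _ : Fin q => (Fin n → F) × ((Fin n → F) × F)) F where
  toFun f := ∑ t, f t • (MultilinearMap.mkPiAlgebra F (Fin q) F).compLinearMap
    fun i => (heisenbergBasis F n).coord (t i)
  map_add' f g := by simp [add_smul, sum_add_distrib]
  map_smul' c f := by simp [mul_smul, smul_sum]

theorem wordForm_apply {q : ℕ} (f : (Fin q → Letter n) → F)
    (a : Fin q → (Fin n → F) × ((Fin n → F) × F)) :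
    wordForm F n q f a = ∑ t, f t * ∏ i, (heisenbergBasis F n).repr (a i) (t i) := by
  simp [wordForm]

theorem wordForm_basis {q : ℕ} (f : (Fin q → Letter n) → F) (t : Fin q → Letter n) :
    wordForm F n q f (heisenbergBasis F n ∘ t) = f t := by
  rw [wordForm_apply, sum_eq_single t]
  · simp
  · intro u _ hu
    obtain ⟨i, hi⟩ := Function.ne_iff.1 hu
    rw [prod_eq_zero (mem_univ i), mul_zero]
    simp [hi.symm]
  · simp

theorem wordForm_eq {q : ℕ} (ω : MultilinearMap F
    (fun _ : Fin q => (Fin n → F) × ((Fin n → F) × F)) F) :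
    wordForm F n q (fun t => ω (heisenbergBasis F n ∘ t)) = ω :=
  Module.Basis.ext_multilinear (fun _ => heisenbergBasis F n) fun t =>
    wordForm_basis (fun t => ω (heisenbergBasis F n ∘ t)) t

theorem wordForm_mem_cochains {q : ℕ} {f : (Fin q → Letter n) → F} (hf : IsSuperAlternating f) :
    wordForm F n q f ∈ (heisenbergOdd F n).cochains q := by
  intro p a ha i j hij
  rw [wordForm_apply, wordForm_apply, mul_sum, ← sum_neg_distrib,
    ← Equiv.sum_comp ((Equiv.swap i j).arrowCongr (Equiv.refl (Letter n)))]
  refine sum_congr rfl fun t _ => ?_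
  have h1 : (Equiv.swap i j).arrowCongr (Equiv.refl (Letter n)) t = t ∘ Equiv.swap i j := by
    ext k : 1
    simp
  have h2 : ∏ k, (heisenbergBasis F n).repr ((a ∘ Equiv.swap i j) k) ((t ∘ Equiv.swap i j) k) =
      ∏ k, (heisenbergBasis F n).repr (a k) (t k) :=
    Equiv.prod_comp (Equiv.swap i j) fun k => (heisenbergBasis F n).repr (a k) (t k)
  rw [h1, h2, hf t i j hij]
  -- Words of the wrong parity contribute nothing: some homogeneous argument has zero coordinate
  -- there.
  by_cases hp : ∀ k, letterParity (t k) = p k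
  · rw [hp, hp]
    ring
  · push Not at hp
    obtain ⟨k, hk⟩ := hp
    rw [prod_eq_zero (mem_univ k) (heisenbergBasis_repr_eq_zero (ha k) hk)]
    ring

theorem isSuperAlternating_of_mem_cochains {q : ℕ} {ω : MultilinearMap F
    (fun _ : Fin q => (Fin n → F) × ((Fin n → F) × F)) F}
    (hω : ω ∈ (heisenbergOdd F n).cochains q) :
    IsSuperAlternating fun t => ω (heisenbergBasis F n ∘ t) :=
  fun t i j hij => hω (fun k => letterParity (t k)) (heisenbergBasis F n ∘ t)
    (fun k => heisenbergBasis_mem_grade (t k)) i j hij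

theorem d_wordForm {q : ℕ} (f : (Fin q → Letter n) → F) :
    (heisenbergOdd F n).d q (wordForm F n q f) = wordForm F n (q + 1) (wordCoboundary f) := by
  rw [← wordForm_eq ((heisenbergOdd F n).d q (wordForm F n q f))]
  congr 1
  ext t
  rw [(heisenbergOdd F n).d_apply_of_homogeneous _ (fun k => letterParity (t k))
    (heisenbergBasis F n ∘ t) (fun k => heisenbergBasis_mem_grade (t k)), wordCoboundary]
  refine sum_congr rfl fun s _ => ?_
  rw [sum_filter]
  refine sum_congr rfl fun r _ => ?_
  split_ifs with h
  · have h1 : Ioo r.castSucc s = univ.filter fun u => r.castSucc < u ∧ u < s := by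
      ext u
      simp
    have h2 : s.removeNth (heisenbergBasis F n ∘ t) = heisenbergBasis F n ∘ s.removeNth t := rfl
    rw [h1, h2, Function.comp_apply, Function.comp_apply, heisenbergOdd_bracket_basis,
      MultilinearMap.map_update_smul, ← Function.comp_update, wordForm_basis, smul_eq_mul]
  · rfl

/-- The cochain given by an element of the Koszul space. -/
def koszulCochain (F : Type*) [Field F] (n q : ℕ) : KoszulSpace F n →ₗ[F]
    MultilinearMap F (fun _ : Fin q => (Fin n → F) × ((Fin n → F) × F)) F :=
  wordForm F n q ∘ₗ
    { toFun := fun G => signedWord (contentFun G)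
      map_add' := fun G H => by
        ext t
        by_cases h : (evenPart (wordContent t)).Nodup <;> simp [signedWord, contentFun, h, mul_add]
      map_smul' := fun c G => by
        ext t
        by_cases h : (evenPart (wordContent t)).Nodup <;>
          simp [signedWord, contentFun, h, mul_left_comm] }

theorem koszulCochain_apply {q : ℕ} (G : KoszulSpace F n) :
    koszulCochain F n q G = wordForm F n q (signedWord (contentFun G)) := rfl

theorem koszulCochain_eq_zero {q : ℕ} {G : KoszulSpace F n} (hG : G ∈ koszulDeg F n q)
    (h : koszulCochain F n q G = 0) : G = 0 := by
  refine eq_zero_of_signedWord_eq_zero hG fun t => ?_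
  rw [← wordForm_basis (signedWord (contentFun G)) t, ← koszulCochain_apply, h]
  rfl

theorem map_koszulCochain [CharZero F] (q : ℕ) :
    (koszulDeg F n q).map (koszulCochain F n q) = (heisenbergOdd F n).cochains q := by
  apply le_antisymm
  · rintro _ ⟨G, -, rfl⟩
    exact wordForm_mem_cochains (isSuperAlternating_signedWord G)
  · intro ω hω
    obtain ⟨G, hG, h⟩ := (isSuperAlternating_of_mem_cochains hω).exists_eq_signedWord
    refine ⟨G, hG, ?_⟩
    rw [koszulCochain_apply, ← h, wordForm_eq]

/-- This is d = -ω ∂/∂ζ: the coboundary replaces a pair x_i, y_i among the arguments by z. -/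
theorem d_koszulCochain (q : ℕ) (G : KoszulSpace F n) :
    (heisenbergOdd F n).d q (koszulCochain F n q G) =
      -koszulCochain F n (q + 1) (koszulMul F n (koszulShift F n G)) := by
  rw [koszulCochain_apply, d_wordForm, koszulCochain_apply, ← map_neg]
  congr 1
  ext t
  rw [wordCoboundary_signedWord, sum_contentTerm]
  rfl

theorem koszulShift_koszulMul (G : KoszulSpace F n) :
    koszulShift F n (koszulMul F n G) = koszulMul F n (koszulShift F n G) := by
  ext S μ
  change koszulMul F n G S (none ::ₘ μ) = _
  rw [koszulMul_apply, koszulMul_apply]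
  refine sum_congr rfl fun i _ => ?_
  rw [Multiset.count_cons_of_ne (by simp), Multiset.erase_cons_tail _ (by simp)]
  rfl

theorem finrank_map_koszulCochain {q : ℕ} {P : Submodule F (KoszulSpace F n)}
    (hP : P ≤ koszulDeg F n q) :
    Module.finrank F (P.map (koszulCochain F n q)) = Module.finrank F P := by
  have : Module.Finite F P := Submodule.finiteDimensional_of_le hP
  rw [← finrank_map_add_finrank_inf_ker P (koszulCochain F n q),
    (?_ : P ⊓ LinearMap.ker (koszulCochain F n q) = ⊥), finrank_bot, add_zero]
  rw [eq_bot_iff]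
  rintro G ⟨hG, h⟩
  exact koszulCochain_eq_zero (hP hG) h

instance [CharZero F] (q : ℕ) : Module.Finite F ((heisenbergOdd F n).cochains q) := by
  rw [← map_koszulCochain]
  infer_instance

theorem finrank_cochains [CharZero F] (q : ℕ) :
    (Module.finrank F ((heisenbergOdd F n).cochains q) : ℤ) = hilbertCoeff n (n + 1) q := by
  rw [← map_koszulCochain, finrank_map_koszulCochain le_rfl, finrank_koszulDeg]

theorem coboundaries_succ [CharZero F] (q : ℕ) : (heisenbergOdd F n).coboundaries (q + 1) =
    (((koszulDeg F n q).map (koszulShift F n)).map (koszulMul F n)).map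
      (koszulCochain F n (q + 1)) := by
  have h : (heisenbergOdd F n).coboundaries (q + 1) =
    ((heisenbergOdd F n).cochains q).map ((heisenbergOdd F n).d q) := rfl
  rw [h, ← map_koszulCochain]
  ext ω
  constructor
  · rintro ⟨_, ⟨G, hG, rfl⟩, rfl⟩
    rw [d_koszulCochain, ← map_neg]
    exact ⟨_, Submodule.neg_mem _ ⟨_, ⟨G, hG, rfl⟩, rfl⟩, rfl⟩
  · rintro ⟨_, ⟨_, ⟨G, hG, rfl⟩, rfl⟩, rfl⟩
    refine ⟨_, ⟨-G, Submodule.neg_mem _ hG, rfl⟩, ?_⟩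
    rw [d_koszulCochain, map_neg, map_neg, map_neg, neg_neg]

theorem coboundaries_one [CharZero F] : (heisenbergOdd F n).coboundaries 1 = ⊥ := by
  rw [coboundaries_succ, map_koszulShift_zero, Submodule.map_bot, Submodule.map_bot]

/-- The shift by two arises because ∂/∂ζ maps the (q+1)-cochains onto degree q before ω is applied.
-/
theorem finrank_coboundaries_add_two [CharZero F] (q : ℕ) :
    (Module.finrank F ((heisenbergOdd F n).coboundaries (q + 2)) : ℤ) = koszulRank F n q := by
  rw [coboundaries_succ, map_koszulShift, finrank_map_koszulCochain, koszulRank]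
  rintro _ ⟨G, hG, rfl⟩
  exact koszulMul_mem hG

theorem finrank_cocycles [CharZero F] (q : ℕ) :
    (Module.finrank F ((heisenbergOdd F n).cocycles q) : ℤ) = hilbertCoeff n (n + 1) q -
      Module.finrank F ((heisenbergOdd F n).coboundaries (q + 1)) := by
  rw [← finrank_cochains (F := F), ← finrank_map_add_finrank_inf_ker
    ((heisenbergOdd F n).cochains q) ((heisenbergOdd F n).d q)]
  push_cast
  exact (add_sub_cancel_left _ _).symm

theorem coboundaries_le_cocycles [CharZero F] (q : ℕ) :
    (heisenbergOdd F n).coboundaries q ≤ (heisenbergOdd F n).cocycles q := by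
  obtain _ | q := q
  · exact bot_le
  · rw [coboundaries_succ]
    rintro _ ⟨_, ⟨_, ⟨G, hG, rfl⟩, rfl⟩, rfl⟩
    refine ⟨wordForm_mem_cochains (isSuperAlternating_signedWord _), LinearMap.mem_ker.2 ?_⟩
    rw [d_koszulCochain, koszulShift_koszulMul, koszulMul_koszulMul, map_zero, neg_zero]

instance [CharZero F] (q : ℕ) : Module.Finite F ((heisenbergOdd F n).cocycles q) :=
  Submodule.finiteDimensional_of_le
    (inf_le_left : (heisenbergOdd F n).cocycles q ≤ (heisenbergOdd F n).cochains q)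

theorem finrank_cohomology [CharZero F] (q : ℕ) :
    (Module.finrank F ((heisenbergOdd F n).Cohomology q) : ℤ) = hilbertCoeff n (n + 1) q -
      Module.finrank F ((heisenbergOdd F n).coboundaries (q + 1)) -
      Module.finrank F ((heisenbergOdd F n).coboundaries q) := by
  have h := Submodule.finrank_quotient_add_finrank (R := F)
    (M := (heisenbergOdd F n).cocycles q)
    (((heisenbergOdd F n).coboundaries q).submoduleOf ((heisenbergOdd F n).cocycles q))
  rw [(Submodule.submoduleOfEquivOfLe (coboundaries_le_cocycles q)).finrank_eq] at h
  rw [← finrank_cocycles, ← h]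
  push_cast
  exact (add_sub_cancel_right _ _).symm

end Heisenberg

end
theorem mainTheorem2 (F : Type*) [Field F] [IsAlgClosed F] [CharZero F]
    (n : ℕ) (hn : 1 ≤ n) (q : ℕ) :
    Module.Finite F ((heisenbergOdd F n).Cohomology q) ∧
    (Module.finrank F ((heisenbergOdd F n).Cohomology q) : ℤ) =
      ∑ p ∈ Finset.range q,
          (((n + 1).choose (q - p) : ℤ) * symDim F n p
            - (n.choose (q - 1 - p) : ℤ) * symDim F (n + 1) p)
        + symDim F n q
        + ∑ i ∈ Finset.Icc 1 (q / 4 + if q % 4 = 2 ∨ q % 4 = 3 then 1 else 0),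
            (∑ p ∈ Finset.range (q - 4 * i),
                ((n + 2).choose (q - 4 * i + 1 - p) : ℤ) * symDim F n p
              + ((n : ℤ) + 2) * symDim F n ((q : ℤ) - 4 * i)
              + symDim F n ((q : ℤ) - 4 * i + 1)
              + (if (q : ℤ) - 4 * i + 1 = n then 1 else 0)
              + 2 * (if (q : ℤ) - 4 * i + 2 = n then 1 else 0)
              + (if (q : ℤ) - 4 * i + 3 = n then 1 else 0)) := by
  refine ⟨inferInstance, ?_⟩
  have hb0 : Module.finrank F ((heisenbergOdd F n).coboundaries 0) = 0 := finrank_bot F _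
  have hb1 : Module.finrank F ((heisenbergOdd F n).coboundaries 1) = 0 := by
    rw [coboundaries_one, finrank_bot]
  -- The right-hand side is `cohomologyDim` unfolded, so only the initial values and the two
  -- recursions remain.
  refine eq_cohomologyDim F hn (σ := koszulRank F n)
    (h := fun q => Module.finrank F ((heisenbergOdd F n).Cohomology q)) ?_ ?_
    koszulRank_add_two ?_ ?_ ?_ q
  · rw [koszulRank_of_lt_two (by omega), hilbertCoeff_zero, if_neg (by omega), sub_zero]
  · exact koszulRank_of_lt_two (by omega)
  · rw [finrank_cohomology, hb0, hb1, hilbertCoeff_zero]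
    simp
  · rw [finrank_cohomology, hb1, finrank_coboundaries_add_two]
    simp
  · intro q
    rw [finrank_cohomology, finrank_coboundaries_add_two, finrank_coboundaries_add_two q]
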